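/- Let $\mathcal I$ (sites) and $\mathcal X$ (spins) be finite sets, $\mathcal Y=\mathcal X^{\mathcal I}$, and let $\mu$ be a probability measure on $\mathcal Y$ (a spin system). For $x\in\mathcal Y$ and $S\subset\mathcal I$ write $x_S=(x_j)_{j\in S}$ and $\overline x_i=(x_j)_{j\neq i}$; let $\mu_S$ be the law of $x_S$, $\overline\mu_i$ the law of $\overline x_i$, and $\mu(\cdot\mid\overline x_i)$ the conditional distribution on $\mathcal X$ of the $i$-th spin given $\overline x_i$. This is determined by $\mu$ if $\overline\mu_i(\overline x_i)>0$. A version of the conditional distributions is a choice of probability measures $\mu(\cdot\mid\overline x_i)$ on $\mathcal X$ for all $i\in\mathcal I$ and all $\overline x_i\in\mathcal X^{\mathcal I\setminus\{i\}}$ which has these values whenever $\overline\mu_i(\overline x_i)>0$. A real matrix $J=(J_{ij})_{i,j\in\mathcal I}$ is an interdependence matrix of $\mu$ if $J_{ii}=0$ for all $i$ and if, for some version of the conditional distributions, $d_{\mathrm{TV}}(\mu(\cdot\mid\overline x_i),\mu(\cdot\mid\overline y_i))\le J_{ij}$ for all $i,j\in\mathcal I$ and all $x,y\in\mathcal Y$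 with $\overline x_j=\overline y_j$, where $d_{\mathrm{TV}}(\nu,\nu')=\frac12\sum_a|\nu(a)-\nu'(a)|$. Put $$\tilde\beta(\mu)=\inf_{S\subsetneq\mathcal I}\ \inf_{i\notin S}\ \inf_{y\in\mathcal Y:\,\mu(y)>0}\mu(y_i\mid y_S),$$ where $\mu(y_i\mid y_S)$ is the conditional probability that the $i$-th spin is $y_i$ given that the spins in $S$ are $y_S$. For $\alpha_1,\alpha_2>0$, $\mu$ is called $(\alpha_1,\alpha_2)$-weakly dependent if $\tilde\beta(\mu)\ge\alpha_1$ and $\|J\|_{2\to2}\le1-\alpha_2$ for some interdependence matrix $J$ of $\mu$. Let $\mathrm{Ent}_\nu(f)=\int f\log f\,d\nu-\int f\,d\nu\,\log\int f\,d\nu$ for $f\ge0$ (with $0\log0=0$). The Glauber dynamics of $\mu$ has the transition probabilities $P(x,y)=|\mathcal I|^{-1}\sum_{i\in\mathcal I}\mu(y_i\mid\overline x_i)\prod_{j\ne i}\mathbf 1_{x_j=y_j}$ (on the support of $\mu$) and the Dirichlet form $\mathcal E(f,g)=\int f\,(g-Pg)\,d\mu$. Let $$|\partial f|^2(x)=\sum_{i\in\mathcal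 I}\frac12\iint\bigl(f(\overline x_i,a)-f(\overline x_i,b)\bigr)^2\,d\mu(a\mid\overline x_i)\,d\mu(b\mid\overline x_i),$$ the $i$-th summand being $0$ if $\overline\mu_i(\overline x_i)=0$. **Theorem.** Let $\mu$ be an $(\alpha_1,\alpha_2)$-weakly dependent spin system, where $\alpha_1,\alpha_2>0$. 1. For every $f:\mathcal Y\to[0,\infty)$ vanishing outside the support of $\mu$, $$\mathrm{Ent}_\mu(f)\le\frac1{\alpha_1\alpha_2^2}\sum_{i\in\mathcal I}\int\mathrm{Ent}_{\mu(\cdot\mid\overline x_i)}\bigl(f(\overline x_i,\cdot)\bigr)\,d\mu(x).$$ 2. The Glauber dynamics of $\mu$ satisfies $\mathrm{mLSI}(\rho_0)$ with $\rho_0=2|\mathcal I|\alpha_1^{-1}\alpha_2^{-2}$, i.e. $\mathrm{Ent}_\mu(f)\le\frac{\rho_0}2\,\mathcal E(f,\log f)$ for every $f:\mathcal Y\to[0,\infty)$, where $\mathcal E(f,\log f)$ is read as $+\infty$ if $f(x)>0=f(y)$ for some $x,y$ with $\mu(x)>0$ and $P(x,y)>0$, and with the convention $0\cdot(-\infty)=0$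 otherwise. 3. $\mu$ satisfies a $\partial$-$\mathrm{LSI}(\sigma^2)$ with $\sigma^2=\dfrac{\log(1/\alpha_1)}{\log(2)\,\alpha_1\alpha_2^2}$, i.e. $\mathrm{Ent}_\mu(f^2)\le2\sigma^2\int|\partial f|^2\,d\mu$ for every $f:\mathcal Y\to\mathbb R$. -/

import Mathlib

namespace SpinSystem

/-! ## Probability vectors on finite sets

A probability measure on a finite set is given by its mass function, i.e. by an element of Mathlib's
`stdSimplex ℝ α`.  The functionals below are defined for an arbitrary weight function. -/

/-- The integral `∫ f dν` of `f` with respect to the measure with mass function `ν`. -/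
noncomputable def expect {α : Type*} [Fintype α] (ν f : α → ℝ) : ℝ :=
  ∑ a, ν a * f a

/-- The entropy `Ent_ν(f) = ∫ f log f dν - ∫ f dν log (∫ f dν)` (with `0 log 0 = 0`). -/
noncomputable def ent {α : Type*} [Fintype α] (ν f : α → ℝ) : ℝ :=
  expect ν (fun a => f a * Real.log (f a)) - expect ν f * Real.log (expect ν f)

/-- The total variation distance `d_TV(ν, ν') = (1/2) ∑ |ν(a) - ν'(a)|`. -/
noncomputable def tv {α : Type*} [Fintype α] (ν ν' : α → ℝ) : ℝ :=
  (1 / 2) * ∑ a, |ν a - ν' a|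

/-- The probability `ν(A)` of an event `A`. -/
noncomputable def prob {α : Type*} [Fintype α] (ν : α → ℝ) (A : Set α) : ℝ :=
  ∑ a, A.indicator ν a

/-! ## Functional inequalities -/

/-- The Dirichlet form `E(f, g) = 𝔼_μ f (-L g)` of the transition matrix `P`, with `-L = I - P`. -/
noncomputable def dirichletForm {Ω : Type*} [Fintype Ω] (P : Ω → Ω → ℝ) (μ f g : Ω → ℝ) : ℝ :=
  expect μ (fun x => f x * (g x - ∑ y, P x y * g y))

/-- The modified logarithmic Sobolev inequality `mLSI(ρ₀)` for `(Ω, P, μ)`: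
`Ent_μ(f) ≤ (ρ₀ / 2) E(f, log f)` for all `f ≥ 0`.

If `f x > 0` and `f y = 0` for some `x` with `μ x > 0` and some `y` with `P x y > 0`, then
`E(f, log f) = +∞` (as `log 0 = -∞`) and the inequality is void.  For every other `f ≥ 0`, that is
for all those singled out by the second hypothesis on `f` (in particular for every positive `f`), all
terms `μ x * f x * P x y * log (f y)` with a nonzero prefactor have `f y > 0`, so that the Dirichlet
form below does not see the value which Lean assigns to `log 0`. -/
def IsMLSI {Ω : Type*} [Fintype Ω] (P : Ω → Ω → ℝ) (μ : Ω → ℝ) (ρ₀ : ℝ) : Prop :=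
  ∀ f : Ω → ℝ, (∀ x, 0 ≤ f x) →
    (∀ x y, 0 < μ x → 0 < P x y → 0 < f x → 0 < f y) →
    ent μ f ≤ ρ₀ / 2 * dirichletForm P μ f (fun x => Real.log (f x))

/-- The logarithmic Sobolev inequality `Γ-LSI(σ²)` with respect to `Γ`:
`Ent_μ(f²) ≤ 2 σ² ∫ Γ(f)² dμ` for all `f`. -/
def IsLSI {Ω : Type*} [Fintype Ω] (Γ : (Ω → ℝ) → Ω → ℝ) (μ : Ω → ℝ) (σsq : ℝ) : Prop :=
  ∀ f : Ω → ℝ, ent μ (fun x => f x ^ 2) ≤ 2 * σsq * expect μ (fun x => Γ f x ^ 2)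

/-! ## Spin systems: conditional probabilities, Glauber dynamics, local variances

The finite set of sites is `I`, the finite set of spins is `X`, configurations are functions
`I → X`. -/

section

variable {I X : Type*} [Fintype I] [DecidableEq I] [Fintype X]

/-- The marginal probability `μ_S(x_S)`. -/
noncomputable def marginal (μ : (I → X) → ℝ) (S : Finset I) (x : I → X) : ℝ :=
  prob μ {z | ∀ j ∈ S, z j = x j}

/-- The conditional probability `μ(z_i = a | z_S = x_S)`, meaningful if `μ_S(x_S) > 0`
(and `0` otherwise). -/
noncomputable def condProb (μ : (I → X) → ℝ) (S : Finset I) (i : I) (x : I → X) (a : X) : ℝ :=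
  prob μ {z | (∀ j ∈ S, z j = x j) ∧ z i = a} / marginal μ S x

/-- The conditional distribution `μ(· | x̄_i)` of the spin at `i` given all the other spins. -/
noncomputable def condSite (μ : (I → X) → ℝ) (i : I) (x : I → X) : X → ℝ :=
  condProb μ {i}ᶜ i x

/-- The transition matrix of the Glauber dynamics,
`P(x, y) = |I|⁻¹ ∑ i, μ(y_i | x̄_i) ∏_{j ≠ i} δ_{x_j = y_j}`. -/
noncomputable def glauber [DecidableEq X] (μ : (I → X) → ℝ) (x y : I → X) : ℝ :=
  (Fintype.card I : ℝ)⁻¹ *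
    ∑ i, condSite μ i x (y i) * ∏ j ∈ Finset.univ.erase i, if x j = y j then 1 else 0

open Classical in
/-- The local variance `(∂_i f(x))²`. -/
noncomputable def localVar (μ : (I → X) → ℝ) (i : I) (f : (I → X) → ℝ) (x : I → X) : ℝ :=
  if 0 < marginal μ {i}ᶜ x then
    (1 / 2) * expect (condSite μ i x) (fun a => expect (condSite μ i x) (fun b =>
      (f (Function.update x i a) - f (Function.update x i b)) ^ 2))
  else 0

/-- The difference operator `|∂ f| = (∑ i, (∂_i f)²)^(1/2)`. -/
noncomputable def gradNorm (μ : (I → X) → ℝ) (f : (I → X) → ℝ) (x : I → X) : ℝ :=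
  √(∑ i, localVar μ i f x)

/-! ## Weak dependence -/

/-- `κ i x` is a version of the conditional distribution `μ(· | x̄_i)`: a probability measure on `X`
for *every* configuration `x`, depending on `x` only through `x̄_i = (x_j)_{j ≠ i}`, and given by the
elementary conditional probabilities whenever `x̄_i` has positive probability.  If every `x̄_i` has
positive probability (e.g. if `μ` has full support), there is exactly one version. -/
structure IsCondVersion (μ : (I → X) → ℝ) (κ : I → (I → X) → X → ℝ) : Prop where
  mem_stdSimplex : ∀ i x, κ i x ∈ stdSimplex ℝ X
  congr : ∀ i x y, (∀ k, k ≠ i → x k = y k) → κ i x = κ i y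
  eq_cond : ∀ i x, 0 < marginal μ {i}ᶜ x → κ i x = condSite μ i x

/-- `J` is an interdependence matrix of `μ`: `J i i = 0`, and
`d_TV(μ(· | x̄_i), μ(· | ȳ_i)) ≤ J i j` for all configurations `x, y ∈ X^I` with `x̄_j = ȳ_j`
(for some version of the conditional distributions). -/
def IsInterdependenceMatrix (μ : (I → X) → ℝ) (J : Matrix I I ℝ) : Prop :=
  (∀ i, J i i = 0) ∧
  ∃ κ : I → (I → X) → X → ℝ, IsCondVersion μ κ ∧
    ∀ (i j : I) (x y : I → X), (∀ k, k ≠ j → x k = y k) → tv (κ i x) (κ i y) ≤ J i j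

/-- `β̃_{i,S}(μ)`: the infimum of `μ(y_i | y_S)` over all configurations `y` with `μ(y) > 0`.
(A configuration `y` is a pair `(x_S, y_{Sᶜ})`, and `μ(y) > 0` implies `μ_S(y_S) > 0`.) -/
noncomputable def betaTildeAt (μ : (I → X) → ℝ) (i : I) (S : Finset I) : EReal :=
  ⨅ (y : I → X) (_ : 0 < μ y), ((condProb μ S i y (y i) : ℝ) : EReal)

/-- `β̃(μ)`: the infimum of `β̃_{i,S}(μ)` over all proper subsets `S` of `I` and `i ∉ S`. -/
noncomputable def betaTilde (μ : (I → X) → ℝ) : EReal :=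
  ⨅ (S : Finset I) (_ : S ⊂ Finset.univ) (i : I) (_ : i ∉ S), betaTildeAt μ i S

/-- `μ` is `(α₁, α₂)`-weakly dependent: `β̃(μ) ≥ α₁`, and some interdependence matrix has
`ℓ² → ℓ²` operator norm at most `1 - α₂`. -/
def IsWeaklyDependent (μ : (I → X) → ℝ) (α₁ α₂ : ℝ) : Prop :=
  ∃ J : Matrix I I ℝ, IsInterdependenceMatrix μ J ∧
    (α₁ : EReal) ≤ betaTilde μ ∧ ‖Matrix.toEuclideanCLM (𝕜 := ℝ) J‖ ≤ 1 - α₂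

end

end SpinSystem

/-!
Entropy is tensorized following Marton.  Write `κ i x` for the conditional distribution of the spin at
`i`, let `q` be `μ` conditioned on the spins in `S`, and let `f ≥ 0` have mean `1` under `q`.

* Take a coupling of `f q` and `q` which minimizes the expected number of mismatches.  Resampling the
  site `i` in both configurations, with an optimal coupling of the two conditional distributions,
  changes only the mismatch probability `d i` at `i`; by minimality and by the definition of the
  interdependence matrix, `d ≤ t + J d`, where `t i` is the mean distance of the conditional
  distributions of `f q` from `κ i`.  Hence `α₂ ‖d‖ ≤ ‖t‖` (`sum_sq_tv_siteLaw_le`).  The minimizing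
  coupling replaces the iteration of the Gibbs sampler.
* The distance of the one-site marginals of `f q` and `q` is at most `d i`, and their relative entropy
  is at most `2 / α₁` times the square of this distance, since the marginals of `q` have atoms of mass
  at least `α₁`.  By Pinsker's inequality, `t i ^ 2` is at most half of the mean conditional entropy at
  `i`.  So the marginal entropies add up to at most `1 / (α₁ α₂²)` times the sum of the mean
  conditional entropies (`sum_ent_siteLaw_le`).
* By the chain rule, the entropy with respect to `q` is a marginal entropy plus the mean entropy after
  one more spin has been pinned.  Averaging over the site that is pinned next, downward induction on `S`
  gives the first claim, with the same constant (`ent_pinned_le`).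

The other claims follow from one-site inequalities: Jensen's inequality for the logarithm bounds the
entropy by the covariance of `f` and `log f` (`ent_le_cov_log`), and a probability measure with atoms
of mass at least `β` satisfies a logarithmic Sobolev inequality with constant
`log (1 / β) / log 2` (`ent_sq_le_of_le_atoms`).
-/

namespace SpinSystem

open InformationTheory

/-! ### Entropy on finite sets -/

section Entropy

variable {α β : Type*} [Fintype α] [Fintype β]

lemma expect_congr {ν f g : α → ℝ} (h : ∀ a, ν a ≠ 0 → f a = g a) : expect ν f = expect ν g := by
  refine Finset.sum_congr rfl fun a _ => ?_
  by_cases ha : ν a = 0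
  · simp [ha]
  · rw [h a ha]

lemma ent_congr {ν f g : α → ℝ} (h : ∀ a, ν a ≠ 0 → f a = g a) : ent ν f = ent ν g := by
  unfold ent
  rw [expect_congr h, expect_congr fun a ha => by rw [h a ha]]

lemma expect_nonneg {ν f : α → ℝ} (hν : ∀ a, 0 ≤ ν a) (hf : ∀ a, 0 ≤ f a) : 0 ≤ expect ν f :=
  Finset.sum_nonneg fun a _ => mul_nonneg (hν a) (hf a)

lemma expect_mono {ν f g : α → ℝ} (hν : ∀ a, 0 ≤ ν a) (h : ∀ a, ν a ≠ 0 → f a ≤ g a) :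
    expect ν f ≤ expect ν g := by
  refine Finset.sum_le_sum fun a _ => ?_
  by_cases ha : ν a = 0
  · simp [ha]
  · exact mul_le_mul_of_nonneg_left (h a ha) (hν a)

lemma expect_const_mul (ν f : α → ℝ) (c : ℝ) : expect ν (fun a => c * f a) = c * expect ν f := by
  simp only [expect, Finset.mul_sum]
  exact Finset.sum_congr rfl fun a _ => by ring

lemma expect_sum {ι : Type*} (s : Finset ι) (ν : α → ℝ) (f : ι → α → ℝ) :
    expect ν (fun a => ∑ i ∈ s, f i a) = ∑ i ∈ s, expect ν (f i) := by
  simp only [expect, Finset.mul_sum]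
  exact Finset.sum_comm

/-- If a nonnegative function has mean `0`, it vanishes at all atoms. -/
lemma eq_zero_of_expect_eq_zero {ν f : α → ℝ} (hν : ∀ a, 0 ≤ ν a) (hf : ∀ a, 0 ≤ f a)
    (h : expect ν f = 0) (a : α) : ν a * f a = 0 :=
  (Finset.sum_eq_zero_iff_of_nonneg fun a _ => mul_nonneg (hν a) (hf a)).1 h a (Finset.mem_univ a)

lemma ent_eq_zero_of_expect_eq_zero {ν f : α → ℝ} (hν : ∀ a, 0 ≤ ν a) (hf : ∀ a, 0 ≤ f a)
    (h : expect ν f = 0) : ent ν f = 0 := by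
  have h0 : ent ν f = ent ν fun _ => 0 := ent_congr fun a ha =>
    (mul_eq_zero.1 (eq_zero_of_expect_eq_zero hν hf h a)).resolve_left ha
  rw [h0]
  simp [ent, expect]

lemma ent_const_mul (ν f : α → ℝ) {c : ℝ} (hc : c ≠ 0) :
    ent ν (fun a => c * f a) = c * ent ν f := by
  have h : ∀ x : ℝ, c * x * Real.log (c * x) = c * (x * Real.log x) + c * Real.log c * x := by
    intro x
    by_cases hx : x = 0
    · simp [hx]
    · rw [Real.log_mul hc hx]; ring
  unfold ent
  rw [expect_const_mul, h, expect_congr fun a _ => h (f a)]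
  simp only [expect, mul_add, Finset.sum_add_distrib, Finset.mul_sum]
  rw [show ∑ a, ν a * (c * Real.log c * f a) = ∑ a, c * Real.log c * (ν a * f a) from
    Finset.sum_congr rfl fun a _ => by ring]
  rw [show ∑ a, ν a * (c * (f a * Real.log (f a))) = ∑ a, c * (ν a * (f a * Real.log (f a))) from
    Finset.sum_congr rfl fun a _ => by ring]
  simp only [← Finset.mul_sum]
  ring

/-- The entropy as the relative entropy of the density `f / ∫ f dν`. -/
lemma ent_eq_klFun {ν f : α → ℝ} (hν : ν ∈ stdSimplex ℝ α) (he : expect ν f ≠ 0) :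
    ent ν f = expect ν f * expect ν (fun a => klFun (f a / expect ν f)) := by
  set e := expect ν f with he'
  have h : ∀ a, e * klFun (f a / e) = f a * Real.log (f a) + (-(Real.log e) - 1) * f a + e := by
    intro a
    rw [klFun_apply]
    by_cases hx : f a = 0
    · simp [hx]
    · rw [Real.log_div hx he]; field_simp; ring
  rw [← expect_const_mul, expect_congr fun a _ => h a]
  have h1 : ∑ a, ν a = 1 := hν.2
  unfold ent
  rw [← he']
  simp only [expect, mul_add, Finset.sum_add_distrib, ← Finset.sum_mul, h1] at he' ⊢
  have h2 : ∑ a, ν a * ((-(Real.log e) - 1) * f a) = (-(Real.log e) - 1) * e := by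
    rw [he', Finset.mul_sum]; exact Finset.sum_congr rfl fun a _ => by ring
  rw [h2]; ring

lemma ent_nonneg {ν f : α → ℝ} (hν : ν ∈ stdSimplex ℝ α) (hf : ∀ a, 0 ≤ f a) : 0 ≤ ent ν f := by
  by_cases he : expect ν f = 0
  · rw [ent_eq_zero_of_expect_eq_zero hν.1 hf he]
  · have h0 := expect_nonneg hν.1 hf
    rw [ent_eq_klFun hν he]
    exact mul_nonneg h0 (expect_nonneg hν.1 fun a => klFun_nonneg (div_nonneg (hf a) h0))

/-- The relative entropy is at most the `χ²`-divergence. -/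
lemma ent_le_chiSq {ν f : α → ℝ} (hν : ν ∈ stdSimplex ℝ α) (hf : ∀ a, 0 ≤ f a)
    (he : expect ν f = 1) : ent ν f ≤ expect ν (fun a => (f a - 1) ^ 2) := by
  rw [ent_eq_klFun hν (by simp [he]), he, one_mul]
  refine expect_mono hν.1 fun a _ => ?_
  rw [div_one, klFun_apply]
  rcases (hf a).eq_or_lt with h | h
  · simp [← h]
  · nlinarith [Real.log_le_sub_one_of_pos h]

/-- Decomposition of the entropy of a mixture `ν = ∑ b, m b • ν' b`. -/
lemma ent_mixture {ν : α → ℝ} {m : β → ℝ} {ν' : β → α → ℝ}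
    (h : ∀ a, ∑ b, m b * ν' b a = ν a) (f : α → ℝ) :
    ent ν f = ent m (fun b => expect (ν' b) f) + expect m (fun b => ent (ν' b) f) := by
  have key : ∀ g : α → ℝ, ∑ b, m b * expect (ν' b) g = expect ν g := by
    intro g
    simp only [expect, Finset.mul_sum, ← h, Finset.sum_mul]
    rw [Finset.sum_comm]
    exact Finset.sum_congr rfl fun a _ => Finset.sum_congr rfl fun b _ => by ring
  simp only [ent]
  rw [← key f, ← key]
  simp only [expect, mul_sub, Finset.sum_sub_distrib]
  ring

/-- The pointwise inequality behind Pinsker's inequality. -/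
lemma three_mul_sq_le_klFun {t : ℝ} (ht : 0 ≤ t) :
    3 * (t - 1) ^ 2 ≤ (2 * t + 4) * klFun t := by
  let g : ℝ → ℝ := fun t => (2 * t + 4) * klFun t - 3 * (t - 1) ^ 2
  have hder : ∀ x : ℝ, 0 < x → HasDerivAt g (4 * (x + 1) * Real.log x - 8 * (x - 1)) x := by
    intro x hx
    have h1 : HasDerivAt (fun t : ℝ => 2 * t + 4) 2 x := by
      simpa using ((hasDerivAt_id x).const_mul 2).add_const 4
    have h2 : HasDerivAt (fun t : ℝ => 3 * (t - 1) ^ 2) (6 * (x - 1)) x := by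
      have := (((hasDerivAt_id x).sub_const 1).pow 2).const_mul 3
      refine this.congr_deriv ?_
      simp; ring
    refine ((h1.mul (hasDerivAt_klFun hx.ne')).sub h2).congr_deriv ?_
    rw [klFun_apply]; ring
  have hcont : Continuous g := by
    have := continuous_klFun
    fun_prop
  have hlog : ∀ x : ℝ, 1 ≤ x → 2 * (x - 1) ≤ (x + 1) * Real.log x := by
    intro x hx
    have h := Real.le_log_one_add_of_nonneg (sub_nonneg.2 hx)
    rw [div_le_iff₀ (by linarith)] at h
    rw [show 1 + (x - 1) = x by ring] at h
    linarith
  have hg1 : g 1 = 0 := by simp [g, klFun_one]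
  suffices h : g 1 ≤ g t by
    rw [hg1] at h
    have : g t = (2 * t + 4) * klFun t - 3 * (t - 1) ^ 2 := rfl
    linarith
  rcases le_total 1 t with h | h
  · refine monotoneOn_of_deriv_nonneg (convex_Ici 1) hcont.continuousOn ?_ ?_
      Set.self_mem_Ici h h <;> rw [interior_Ici]
    · exact fun x hx => (hder x (one_pos.trans hx)).differentiableAt.differentiableWithinAt
    · intro x hx
      rw [(hder x (one_pos.trans hx)).deriv]
      linarith [hlog x (le_of_lt hx)]
  · refine antitoneOn_of_deriv_nonpos (convex_Icc 0 1) hcont.continuousOn ?_ ?_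
      ⟨ht, h⟩ (Set.right_mem_Icc.2 zero_le_one) h <;> rw [interior_Icc]
    · exact fun x hx => (hder x hx.1).differentiableAt.differentiableWithinAt
    · intro x hx
      rw [(hder x hx.1).deriv]
      have h := hlog x⁻¹ ((one_le_inv₀ hx.1).2 hx.2.le)
      rw [Real.log_inv] at h
      have h2 := mul_le_mul_of_nonneg_left h hx.1.le
      have h3 : x * x⁻¹ = 1 := mul_inv_cancel₀ hx.1.ne'
      have h4 : x * (2 * (x⁻¹ - 1)) = 2 * (1 - x) := by linear_combination 2 * h3
      have h5 : x * ((x⁻¹ + 1) * -Real.log x) = -((1 + x) * Real.log x) := by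
        linear_combination -Real.log x * h3
      linarith

/-- Pinsker's inequality, in homogeneous form. -/
lemma sq_expect_abs_sub_le {ν f : α → ℝ} (hν : ν ∈ stdSimplex ℝ α) (hf : ∀ a, 0 ≤ f a) :
    (expect ν fun a => |f a - expect ν f|) ^ 2 ≤ 2 * expect ν f * ent ν f := by
  by_cases he : expect ν f = 0
  · have h0 : expect ν (fun a => |f a - expect ν f|) = expect ν fun _ => 0 :=
      expect_congr fun a ha => by
        rw [he, (mul_eq_zero.1 (eq_zero_of_expect_eq_zero hν.1 hf he a)).resolve_left ha]; simp
    rw [h0, he]; simp [expect]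
  have hpos : 0 < expect ν f := lt_of_le_of_ne (expect_nonneg hν.1 hf) (Ne.symm he)
  rw [ent_eq_klFun hν he]
  set e := expect ν f with he'
  have h1 : expect ν (fun a => |f a - e|) = e * expect ν (fun a => |f a / e - 1|) := by
    rw [← expect_const_mul]
    refine expect_congr fun a _ => ?_
    rw [show f a - e = e * (f a / e - 1) by field_simp, abs_mul, abs_of_pos hpos]
  have h2 : expect ν (fun a => (2 * (f a / e) + 4) / 3) = 2 := by
    have : ∀ a, (2 * (f a / e) + 4) / 3 = 2 / (3 * e) * f a + 4 / 3 := fun a => by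
      field_simp
    rw [expect_congr fun a _ => this a]
    simp only [expect, mul_add, Finset.sum_add_distrib, ← Finset.sum_mul]
    rw [show ∑ a, ν a = 1 from hν.2]
    have : ∑ a, ν a * (2 / (3 * e) * f a) = 2 / (3 * e) * e := by
      exact expect_const_mul ν f _
    rw [this]; field_simp; norm_num
  have h3 : (expect ν fun a => |f a / e - 1|) ^ 2 ≤
      expect ν (fun a => (2 * (f a / e) + 4) / 3) * expect ν (fun a => klFun (f a / e)) := by
    refine Finset.sum_sq_le_sum_mul_sum_of_sq_le_mul _ (fun a _ => ?_) (fun a _ => ?_) fun a _ => ?_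
    · have := div_nonneg (hf a) hpos.le
      exact mul_nonneg (hν.1 a) (by positivity)
    · exact mul_nonneg (hν.1 a) (klFun_nonneg (div_nonneg (hf a) hpos.le))
    · rw [mul_pow, sq_abs]
      have := three_mul_sq_le_klFun (div_nonneg (hf a) hpos.le)
      nlinarith [sq_nonneg (ν a)]
  rw [h2] at h3
  rw [h1, mul_pow]
  nlinarith [sq_nonneg e]

/-- Jensen's inequality for the logarithm, as a bound of the entropy by a covariance. -/
lemma ent_le_cov_log {ν f : α → ℝ} (hν : ν ∈ stdSimplex ℝ α) (hf : ∀ a, ν a ≠ 0 → 0 < f a) :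
    ent ν f ≤ expect ν (fun a => f a *
      (Real.log (f a) - expect ν fun b => Real.log (f b))) := by
  have h1 : ∑ a, ν a = 1 := hν.2
  have he : 0 < expect ν f := by
    obtain ⟨a, -, ha⟩ := Finset.exists_ne_zero_of_sum_ne_zero (h1.trans_ne one_ne_zero)
    have : ∀ b, 0 ≤ ν b * f b := fun b => by
      by_cases hb : ν b = 0
      · simp [hb]
      · exact mul_nonneg (hν.1 b) (hf b hb).le
    exact Finset.sum_pos' (fun b _ => this b)
      ⟨a, Finset.mem_univ a, mul_pos (lt_of_le_of_ne (hν.1 a) (Ne.symm ha)) (hf a ha)⟩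
  set e := expect ν f with he'
  set l := expect ν (fun b => Real.log (f b)) with hl
  have h2 : l ≤ Real.log e := by
    have h3 : l ≤ expect ν (fun a => Real.log e + (e⁻¹ * f a - 1)) :=
      expect_mono hν.1 fun a ha => by
        have := Real.log_le_sub_one_of_pos (div_pos (hf a ha) he)
        rw [Real.log_div (hf a ha).ne' he.ne', div_eq_inv_mul] at this
        linarith
    have h4 : expect ν (fun a => Real.log e + (e⁻¹ * f a - 1)) =
        Real.log e + (e⁻¹ * e - 1) := by
      simp only [expect, mul_add, mul_sub, Finset.sum_add_distrib, Finset.sum_sub_distrib, mul_one,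
        ← Finset.sum_mul, h1, he', Finset.mul_sum]
      rw [one_mul]
      congr 2
      exact Finset.sum_congr rfl fun a _ => by ring
    rw [inv_mul_cancel₀ he.ne'] at h4
    linarith
  have h5 : expect ν (fun a => f a * (Real.log (f a) - l)) =
      expect ν (fun a => f a * Real.log (f a)) - l * e := by
    simp only [expect, mul_sub, Finset.sum_sub_distrib, he', Finset.mul_sum]
    congr 1
    exact Finset.sum_congr rfl fun a _ => by ring
  rw [h5, ent, ← he']
  nlinarith

/-- A centred vector has `ℓ²`-norm at most `√2` times half its `ℓ¹`-norm. -/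
lemma sum_sq_le_of_sum_eq_zero {u : α → ℝ} (h : ∑ a, u a = 0) :
    ∑ a, u a ^ 2 ≤ 2 * ((1 / 2) * ∑ a, |u a|) ^ 2 := by
  classical
  have h1 : ∀ a, |u a| ≤ (1 / 2) * ∑ b, |u b| := by
    intro a
    rw [← Finset.add_sum_erase _ _ (Finset.mem_univ a)] at h ⊢
    have h2 : |u a| ≤ ∑ b ∈ Finset.univ.erase a, |u b| := by
      rw [eq_neg_of_add_eq_zero_left h, abs_neg]
      exact Finset.abs_sum_le_sum_abs _ _
    linarith
  calc ∑ a, u a ^ 2 ≤ ∑ a, (1 / 2 * ∑ b, |u b|) * |u a| :=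
        Finset.sum_le_sum fun a _ => by
          rw [← sq_abs, sq]; exact mul_le_mul_of_nonneg_right (h1 a) (abs_nonneg _)
    _ = _ := by rw [← Finset.mul_sum]; ring

end Entropy

/-! ### Couplings and resampling of a single spin -/

section Coupling

/-- `π` is a coupling of the mass functions `p` and `q`. -/
structure IsCoupling {Ω Ω' : Type*} [Fintype Ω] [Fintype Ω'] (π : Ω → Ω' → ℝ) (p : Ω → ℝ)
    (q : Ω' → ℝ) : Prop where
  nonneg : ∀ x y, 0 ≤ π x y
  sum_right : ∀ x, ∑ y, π x y = p x
  sum_left : ∀ y, ∑ x, π x y = q y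

lemma tv_nonneg {α : Type*} [Fintype α] (u v : α → ℝ) : 0 ≤ tv u v :=
  mul_nonneg (by norm_num) (Finset.sum_nonneg fun _ _ => abs_nonneg _)

lemma tv_triangle {α : Type*} [Fintype α] (u v w : α → ℝ) : tv u w ≤ tv u v + tv v w := by
  unfold tv
  rw [← mul_add, ← Finset.sum_add_distrib]
  exact mul_le_mul_of_nonneg_left (Finset.sum_le_sum fun a _ => abs_sub_le _ _ _) (by norm_num)

section

variable {Ω Ω' : Type*} [Fintype Ω] [Fintype Ω'] {p : Ω → ℝ} {q : Ω' → ℝ} {π : Ω → Ω' → ℝ}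

lemma isCoupling_mul (hp : p ∈ stdSimplex ℝ Ω) (hq : q ∈ stdSimplex ℝ Ω') :
    IsCoupling (fun x y => p x * q y) p q where
  nonneg x y := mul_nonneg (hp.1 x) (hq.1 y)
  sum_right x := by rw [← Finset.mul_sum, hq.2, mul_one]
  sum_left y := by rw [← Finset.sum_mul, hp.2, one_mul]

lemma IsCoupling.left_ne_zero (h : IsCoupling π p q) {x : Ω} {y : Ω'} (hxy : π x y ≠ 0) :
    p x ≠ 0 := fun h0 =>
  hxy ((Finset.sum_eq_zero_iff_of_nonneg fun y _ => h.nonneg x y).1 ((h.sum_right x).trans h0) y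
    (Finset.mem_univ y))

lemma IsCoupling.right_ne_zero (h : IsCoupling π p q) {x : Ω} {y : Ω'} (hxy : π x y ≠ 0) :
    q y ≠ 0 := fun h0 =>
  hxy ((Finset.sum_eq_zero_iff_of_nonneg fun x _ => h.nonneg x y).1 ((h.sum_left y).trans h0) x
    (Finset.mem_univ x))

lemma IsCoupling.sum_mul_left (h : IsCoupling π p q) (g : Ω → ℝ) :
    ∑ x, ∑ y, π x y * g x = ∑ x, p x * g x :=
  Finset.sum_congr rfl fun x _ => by rw [← Finset.sum_mul, h.sum_right]

lemma IsCoupling.sum_mul_right (h : IsCoupling π p q) (g : Ω' → ℝ) :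
    ∑ x, ∑ y, π x y * g y = ∑ y, q y * g y := by
  rw [Finset.sum_comm]
  exact Finset.sum_congr rfl fun y _ => by rw [← Finset.sum_mul, h.sum_left]

/-- By compactness of the set of couplings, continuous functionals have minimizing couplings. -/
lemma exists_isCoupling_forall_le (hp : p ∈ stdSimplex ℝ Ω) (hq : q ∈ stdSimplex ℝ Ω')
    {F : (Ω → Ω' → ℝ) → ℝ} (hF : Continuous F) :
    ∃ π, IsCoupling π p q ∧ ∀ π', IsCoupling π' p q → F π ≤ F π' := by
  have hclosed : IsClosed {π : Ω → Ω' → ℝ | IsCoupling π p q} := by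
    have : {π : Ω → Ω' → ℝ | IsCoupling π p q} = {π | ∀ x y, 0 ≤ π x y} ∩
        ({π | ∀ x, ∑ y, π x y = p x} ∩ {π | ∀ y, ∑ x, π x y = q y}) := by
      ext π
      exact ⟨fun h => ⟨h.1, h.2, h.3⟩, fun h => ⟨h.1, h.2.1, h.2.2⟩⟩
    rw [this]
    simp only [Set.ofPred_forall]
    refine IsClosed.inter ?_ (IsClosed.inter ?_ ?_)
    · exact isClosed_iInter fun x => isClosed_iInter fun y =>
        isClosed_le continuous_const (by fun_prop)
    · exact isClosed_iInter fun x => isClosed_eq (by fun_prop) continuous_const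
    · exact isClosed_iInter fun x => isClosed_eq (by fun_prop) continuous_const
  have hcompact : IsCompact {π : Ω → Ω' → ℝ | IsCoupling π p q} := by
    refine (isCompact_Icc (a := 0) (b := fun x _ => p x)).of_isClosed_subset hclosed ?_
    intro π h
    refine ⟨fun x y => h.nonneg x y, fun x y => ?_⟩
    change π x y ≤ p x
    rw [← h.sum_right x]
    exact Finset.single_le_sum (fun y _ => h.nonneg x y) (Finset.mem_univ y)
  obtain ⟨π, hπ, hmin⟩ := hcompact.exists_isMinOn ⟨_, isCoupling_mul hp hq⟩ hF.continuousOn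
  exact ⟨π, hπ, fun π' h => hmin h⟩

end

/-- Two probability vectors have a coupling under which the probability of a mismatch is at most
their total variation distance. -/
lemma exists_isCoupling_mismatch_le_tv {α : Type*} [Fintype α] [DecidableEq α] {u v : α → ℝ}
    (hu : u ∈ stdSimplex ℝ α) (hv : v ∈ stdSimplex ℝ α) :
    ∃ c, IsCoupling c u v ∧ ∑ a, ∑ b, c a b * (if a = b then 0 else 1) ≤ tv u v := by
  -- `r` and `s` are the positive and negative part of `u - v`; both have total mass `tv u v`
  set τ := tv u v with hτ
  set r : α → ℝ := fun a => (|u a - v a| + (u a - v a)) / 2 with hr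
  set s : α → ℝ := fun a => (|u a - v a| - (u a - v a)) / 2 with hs
  have hr0 : ∀ a, 0 ≤ r a := fun a => by
    have := neg_abs_le (u a - v a); simp only [hr]; linarith
  have hs0 : ∀ a, 0 ≤ s a := fun a => by
    have := le_abs_self (u a - v a); simp only [hs]; linarith
  have hrs : ∑ a, r a = τ := by
    simp only [hr, ← Finset.sum_div, Finset.sum_add_distrib, Finset.sum_sub_distrib, hu.2, hv.2,
      hτ, tv]
    ring
  have hss : ∑ a, s a = τ := by
    simp only [hs, ← Finset.sum_div, Finset.sum_sub_distrib, hu.2, hv.2, hτ, tv]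
    ring
  have hτ0 : 0 ≤ τ := tv_nonneg u v
  have hrτ : ∀ a, r a * τ / τ = r a := by
    intro a
    by_cases h : τ = 0
    · rw [(Finset.sum_eq_zero_iff_of_nonneg fun a _ => hr0 a).1 (hrs.trans h) a
        (Finset.mem_univ a)]; simp
    · field_simp
  have hsτ : ∀ a, τ * s a / τ = s a := by
    intro a
    by_cases h : τ = 0
    · rw [(Finset.sum_eq_zero_iff_of_nonneg fun a _ => hs0 a).1 (hss.trans h) a
        (Finset.mem_univ a)]; simp
    · field_simp
  have hmin : ∀ a, 0 ≤ u a - r a := by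
    intro a
    have h1 := hu.1 a
    have h2 := hv.1 a
    simp only [hr]
    rcases abs_cases (u a - v a) with h | h <;> linarith
  have hus : ∀ a, u a - r a = v a - s a := fun a => by simp only [hr, hs]; ring
  refine ⟨fun a b => (if a = b then u a - r a else 0) + r a * s b / τ, ⟨?_, ?_, ?_⟩, ?_⟩
  · intro a b
    have h1 := mul_nonneg (hr0 a) (hs0 b)
    have h2 := hmin a
    split_ifs <;> positivity
  · intro a
    rw [Finset.sum_add_distrib, Finset.sum_ite_eq, if_pos (Finset.mem_univ a), ← Finset.sum_div,
      ← Finset.mul_sum, hss, hrτ]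
    ring
  · intro b
    rw [Finset.sum_add_distrib, Finset.sum_ite_eq', if_pos (Finset.mem_univ b), ← Finset.sum_div,
      ← Finset.sum_mul, hrs, hsτ, hus]
    ring
  · have h1 : ∑ a, ∑ b, r a * s b / τ = τ := by
      calc ∑ a, ∑ b, r a * s b / τ = ∑ a, r a * τ / τ := by
            refine Finset.sum_congr rfl fun a _ => ?_
            rw [← Finset.sum_div, ← Finset.mul_sum, hss]
        _ = τ := by rw [Finset.sum_congr rfl fun a _ => hrτ a, hrs]
    refine le_trans (Finset.sum_le_sum fun a _ => Finset.sum_le_sum fun b _ => ?_) h1.le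
    have h2 : 0 ≤ r a * s b / τ := div_nonneg (mul_nonneg (hr0 a) (hs0 b)) hτ0
    by_cases h : a = b
    · simpa [h] using h2
    · simp [h]

variable {I X : Type*} [Fintype I] [DecidableEq I] [Fintype X] [DecidableEq X]

/-- The law of the `i`-th spin under `p`. -/
noncomputable def siteLaw (p : (I → X) → ℝ) (i : I) (a : X) : ℝ :=
  ∑ x, if x i = a then p x else 0

/-- The probability that the two configurations differ at the site `i` under the coupling `π`. -/
noncomputable def mismatch (π : (I → X) → (I → X) → ℝ) (i : I) : ℝ :=
  ∑ x, ∑ y, π x y * (if x i = y i then 0 else 1)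

lemma mismatch_nonneg {π : (I → X) → (I → X) → ℝ} {p q : (I → X) → ℝ} (h : IsCoupling π p q)
    (i : I) : 0 ≤ mismatch π i :=
  Finset.sum_nonneg fun x _ => Finset.sum_nonneg fun y _ =>
    mul_nonneg (h.nonneg x y) (by split_ifs <;> norm_num)

lemma sum_siteLaw_mul (p : (I → X) → ℝ) (i : I) (g : X → ℝ) :
    ∑ a, siteLaw p i a * g a = ∑ x, p x * g (x i) := by
  simp only [siteLaw, Finset.sum_mul, ite_mul, zero_mul]
  rw [Finset.sum_comm]
  exact Finset.sum_congr rfl fun x _ => by simp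

lemma tv_siteLaw_le_mismatch {π : (I → X) → (I → X) → ℝ} {p q : (I → X) → ℝ}
    (h : IsCoupling π p q) (i : I) : tv (siteLaw p i) (siteLaw q i) ≤ mismatch π i := by
  have h1 : ∀ a, siteLaw p i a - siteLaw q i a =
      ∑ x, ∑ y, π x y * ((if x i = a then 1 else 0) - if y i = a then 1 else 0) := by
    intro a
    simp only [mul_sub, Finset.sum_sub_distrib]
    rw [h.sum_mul_left fun x => if x i = a then (1 : ℝ) else 0,
      h.sum_mul_right fun x => if x i = a then (1 : ℝ) else 0]
    simp [siteLaw]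
  have h2 : ∀ a, |siteLaw p i a - siteLaw q i a| ≤
      ∑ x, ∑ y, π x y * |(if x i = a then (1 : ℝ) else 0) - if y i = a then 1 else 0| := by
    intro a
    rw [h1]
    refine (Finset.abs_sum_le_sum_abs _ _).trans (Finset.sum_le_sum fun x _ => ?_)
    refine (Finset.abs_sum_le_sum_abs _ _).trans (Finset.sum_le_sum fun y _ => ?_)
    rw [abs_mul, abs_of_nonneg (h.nonneg x y)]
  have h3 : ∀ a b : X, ∑ c, |(if a = c then (1 : ℝ) else 0) - if b = c then 1 else 0| =
      2 * if a = b then 0 else 1 := by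
    intro a b
    by_cases hab : a = b
    · simp [hab]
    · have : ∀ c, |(if a = c then (1 : ℝ) else 0) - if b = c then 1 else 0| =
          (if a = c then 1 else 0) + if b = c then 1 else 0 := by
        intro c
        by_cases h1 : a = c
        · have : b ≠ c := fun h => hab (h1.trans h.symm)
          simp [h1, this]
        · by_cases h2 : b = c <;> simp [h1, h2]
      simp [this, Finset.sum_add_distrib, hab]
      norm_num
  have h4 : ∑ a, |siteLaw p i a - siteLaw q i a| ≤ 2 * mismatch π i := by
    refine (Finset.sum_le_sum fun a _ => h2 a).trans_eq ?_
    rw [Finset.sum_comm, mismatch, Finset.mul_sum]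
    refine Finset.sum_congr rfl fun x _ => ?_
    rw [Finset.sum_comm, Finset.mul_sum]
    refine Finset.sum_congr rfl fun y _ => ?_
    rw [← Finset.mul_sum, h3]; ring
  unfold tv
  linarith

/-- The mass function `ρ` is reversible for the resampling of the spin at `i` according to the
kernel `k`, i.e. `k` is a version of the conditional distribution of the spin at `i` given the
others.  Normalization of `k` and `ρ` is not included. -/
structure IsResampling (k : (I → X) → X → ℝ) (i : I) (ρ : (I → X) → ℝ) : Prop where
  congr : ∀ x y, (∀ j, j ≠ i → x j = y j) → k x = k y
  eq_mul : ∀ x, ρ x = k x (x i) * ∑ b, ρ (Function.update x i b)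

omit [Fintype I] [DecidableEq X] in
lemma IsResampling.update {k : (I → X) → X → ℝ} {i : I} {ρ : (I → X) → ℝ}
    (h : IsResampling k i ρ) (x : I → X) (a : X) : k (Function.update x i a) = k x :=
  h.congr _ _ fun _ hj => Function.update_of_ne hj _ _

omit [DecidableEq X] in
/-- Resampling the spin at `i` leaves `ρ` invariant. -/
lemma IsResampling.sum_mul {k : (I → X) → X → ℝ} {i : I} {ρ : (I → X) → ℝ}
    (h : IsResampling k i ρ) (G : (I → X) → ℝ) :
    ∑ x, ρ x * ∑ a, k x a * G (Function.update x i a) = ∑ x, ρ x * G x := by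
  -- the involution exchanging the spin `x i` with the resampled value
  let e : (I → X) × X ≃ (I → X) × X :=
    { toFun := fun z => (Function.update z.1 i z.2, z.1 i)
      invFun := fun z => (Function.update z.1 i z.2, z.1 i)
      left_inv := fun z => by simp
      right_inv := fun z => by simp }
  calc ∑ x, ρ x * ∑ a, k x a * G (Function.update x i a)
      = ∑ z : (I → X) × X, ρ z.1 * (k z.1 z.2 * G (Function.update z.1 i z.2)) := by
        rw [Fintype.sum_prod_type]
        exact Finset.sum_congr rfl fun x _ => by rw [Finset.mul_sum]
    _ = ∑ z : (I → X) × X, ρ (Function.update z.1 i z.2) * (k z.1 (z.1 i) * G z.1) := by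
        rw [← Equiv.sum_comp e]
        refine Finset.sum_congr rfl fun z _ => ?_
        simp only [e, Equiv.coe_fn_mk, Function.update_idem, Function.update_eq_self, h.update]
    _ = ∑ x, ρ x * G x := by
        rw [Fintype.sum_prod_type]
        refine Finset.sum_congr rfl fun x _ => ?_
        change ∑ a, ρ (Function.update x i a) * (k x (x i) * G x) = _
        rw [← Finset.sum_mul, h.eq_mul x]
        ring

/-- Resampling both configurations at the site `i`, with an optimal coupling of the two kernels,
only affects the mismatch at `i`. -/
lemma exists_isCoupling_resample {π : (I → X) → (I → X) → ℝ} {p q : (I → X) → ℝ}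
    (h : IsCoupling π p q) {i : I} {k k' : (I → X) → X → ℝ}
    (hk : ∀ x, k x ∈ stdSimplex ℝ X) (hk' : ∀ x, k' x ∈ stdSimplex ℝ X)
    (hp : IsResampling k i p) (hq : IsResampling k' i q) :
    ∃ π', IsCoupling π' p q ∧ (∀ j, j ≠ i → mismatch π' j = mismatch π j) ∧
      mismatch π' i ≤ ∑ x, ∑ y, π x y * tv (k x) (k' y) := by
  choose c hc hctv using fun x y => exists_isCoupling_mismatch_le_tv (hk x) (hk' y)
  let π' : (I → X) → (I → X) → ℝ := fun x' y' => ∑ x, ∑ y, π x y * ∑ a, ∑ b, c x y a b *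
    ((if Function.update x i a = x' then 1 else 0) *
      (if Function.update y i b = y' then 1 else 0))
  have key : ∀ G : (I → X) → (I → X) → ℝ, ∑ x', ∑ y', π' x' y' * G x' y' =
      ∑ x, ∑ y, π x y * ∑ a, ∑ b, c x y a b * G (Function.update x i a) (Function.update y i b) := by
    intro G
    have h1 : ∀ x y : I → X, ∑ x', ∑ y', ((if x = x' then 1 else 0) *
        (if y = y' then 1 else 0)) * G x' y' = G x y := by
      intro x y
      simp [Finset.sum_ite_eq]
    calc ∑ x', ∑ y', π' x' y' * G x' y'
        = ∑ z : (I → X) × (I → X), ∑ w : (I → X) × (I → X), ∑ d : X × X,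
            π w.1 w.2 * c w.1 w.2 d.1 d.2 * (((if Function.update w.1 i d.1 = z.1 then 1 else 0) *
            (if Function.update w.2 i d.2 = z.2 then 1 else 0)) * G z.1 z.2) := by
          simp only [Fintype.sum_prod_type, π', Finset.sum_mul, Finset.mul_sum, mul_assoc]
      _ = ∑ w : (I → X) × (I → X), ∑ d : X × X, ∑ z : (I → X) × (I → X),
            π w.1 w.2 * c w.1 w.2 d.1 d.2 * (((if Function.update w.1 i d.1 = z.1 then 1 else 0) *
            (if Function.update w.2 i d.2 = z.2 then 1 else 0)) * G z.1 z.2) := by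
          rw [Finset.sum_comm]
          exact Finset.sum_congr rfl fun w _ => Finset.sum_comm
      _ = _ := by
          simp only [← Finset.mul_sum]
          have h2 : ∀ x y : I → X, ∑ z : (I → X) × (I → X), ((if x = z.1 then 1 else 0) *
              (if y = z.2 then 1 else 0)) * G z.1 z.2 = G x y := fun x y => by
            rw [Fintype.sum_prod_type]; exact h1 x y
          simp only [h2]
          simp only [Fintype.sum_prod_type, Finset.mul_sum, mul_assoc]
  have hsum : ∀ x y, ∑ a, ∑ b, c x y a b = 1 := fun x y => by
    rw [← (hk x).2]; exact Finset.sum_congr rfl fun a _ => (hc x y).sum_right a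
  refine ⟨π', ⟨?_, ?_, ?_⟩, ?_, ?_⟩
  · intro x' y'
    refine Finset.sum_nonneg fun x _ => Finset.sum_nonneg fun y _ => mul_nonneg (h.nonneg x y) ?_
    refine Finset.sum_nonneg fun a _ => Finset.sum_nonneg fun b _ =>
      mul_nonneg ((hc x y).nonneg a b) (mul_nonneg ?_ ?_) <;> split_ifs <;> norm_num
  · intro x₀
    have h1 := key fun x' _ => if x' = x₀ then 1 else 0
    have h2 : ∀ x y, ∑ a, ∑ b, c x y a b * (if Function.update x i a = x₀ then (1 : ℝ) else 0) =
        ∑ a, k x a * (if Function.update x i a = x₀ then (1 : ℝ) else 0) := fun x y =>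
      (hc x y).sum_mul_left fun a => if Function.update x i a = x₀ then (1 : ℝ) else 0
    simp only [h2] at h1
    rw [h.sum_mul_left fun x => ∑ a, k x a * (if Function.update x i a = x₀ then (1 : ℝ) else 0),
      hp.sum_mul fun x => if x = x₀ then (1 : ℝ) else 0] at h1
    simpa [← Finset.sum_mul] using h1
  · intro y₀
    have h1 := key fun _ y' => if y' = y₀ then 1 else 0
    have h2 : ∀ x y, ∑ a, ∑ b, c x y a b * (if Function.update y i b = y₀ then (1 : ℝ) else 0) =
        ∑ b, k' y b * (if Function.update y i b = y₀ then (1 : ℝ) else 0) := fun x y =>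
      (hc x y).sum_mul_right fun b => if Function.update y i b = y₀ then (1 : ℝ) else 0
    simp only [h2] at h1
    rw [h.sum_mul_right fun y => ∑ a, k' y a * (if Function.update y i a = y₀ then (1 : ℝ) else 0),
      hq.sum_mul fun y => if y = y₀ then (1 : ℝ) else 0, Finset.sum_comm] at h1
    simpa [← Finset.sum_mul] using h1
  · intro j hj
    rw [mismatch, key fun x y => if x j = y j then 0 else 1]
    simp only [Function.update_of_ne hj, ← Finset.sum_mul, hsum, one_mul]
    rfl
  · rw [mismatch, key fun x y => if x i = y i then 0 else 1]
    refine Finset.sum_le_sum fun x _ => Finset.sum_le_sum fun y _ =>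
      mul_le_mul_of_nonneg_left ?_ (h.nonneg x y)
    simpa using hctv x y

end Coupling

/-! ### Contraction under Dobrushin's condition -/

section Contraction

/-- If `d ≤ t + J d` entrywise for a nonnegative matrix `J` of norm at most `1 - α < 1`, then
`α ‖d‖ ≤ ‖t‖`. -/
lemma sq_mul_sum_sq_le {I : Type*} [Fintype I] [DecidableEq I] {J : Matrix I I ℝ} {α : ℝ}
    (hα : 0 < α) (hJ : ‖Matrix.toEuclideanCLM (𝕜 := ℝ) J‖ ≤ 1 - α) {d t : I → ℝ}
    (hd : ∀ i, 0 ≤ d i) (h : ∀ i, d i ≤ t i + ∑ j, J i j * d j) :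
    α ^ 2 * ∑ i, d i ^ 2 ≤ ∑ i, t i ^ 2 := by
  set D : EuclideanSpace ℝ I := WithLp.toLp 2 d with hD
  set T : EuclideanSpace ℝ I := WithLp.toLp 2 t with hT
  have h1 : ‖D‖ ≤ ‖T + Matrix.toEuclideanCLM (𝕜 := ℝ) J D‖ := by
    rw [EuclideanSpace.norm_eq, EuclideanSpace.norm_eq]
    refine Real.sqrt_le_sqrt (Finset.sum_le_sum fun i _ => ?_)
    have h2 : (T + Matrix.toEuclideanCLM (𝕜 := ℝ) J D) i = t i + ∑ j, J i j * d j := rfl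
    rw [h2, show D i = d i from rfl, Real.norm_of_nonneg (hd i)]
    exact pow_le_pow_left₀ (hd i) ((h i).trans (le_abs_self _)) 2
  have h2 : ‖Matrix.toEuclideanCLM (𝕜 := ℝ) J D‖ ≤ (1 - α) * ‖D‖ :=
    (ContinuousLinearMap.le_opNorm _ _).trans (mul_le_mul_of_nonneg_right hJ (norm_nonneg _))
  have h3 : α * ‖D‖ ≤ ‖T‖ := by linarith [norm_add_le T (Matrix.toEuclideanCLM (𝕜 := ℝ) J D)]
  have h4 := pow_le_pow_left₀ (mul_nonneg hα.le (norm_nonneg D)) h3 2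
  rw [mul_pow, EuclideanSpace.norm_sq_eq, EuclideanSpace.norm_sq_eq] at h4
  simpa [hD, hT] using h4

variable {I X : Type*} [Fintype I] [DecidableEq I] [Fintype X] [DecidableEq X]

/-- Changing the spins one after the other. -/
lemma tv_le_sum_mismatch {κ : (I → X) → X → ℝ} {c : I → ℝ}
    (h : ∀ j x y, (∀ k, k ≠ j → x k = y k) → tv (κ x) (κ y) ≤ c j) (x y : I → X) :
    tv (κ x) (κ y) ≤ ∑ j, c j * (if x j = y j then 0 else 1) := by
  have key : ∀ s : Finset I, tv (κ x) (κ (s.piecewise y x)) ≤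
      ∑ j ∈ s, c j * (if x j = y j then 0 else 1) := by
    intro s
    induction s using Finset.induction_on with
    | empty => simp [tv]
    | insert j s hj ih =>
      rw [Finset.sum_insert hj, Finset.piecewise_insert, add_comm]
      refine (tv_triangle _ (κ (s.piecewise y x)) _).trans (add_le_add ih ?_)
      by_cases hxy : x j = y j
      · rw [← hxy]
        have : Function.update (s.piecewise y x) j (x j) = s.piecewise y x := by
          rw [Function.update_eq_self_iff]; simp [hj]
        rw [this]
        simp [tv]
      · rw [if_neg hxy, mul_one]
        exact h j _ _ fun k hk => (Function.update_of_ne hk _ _).symm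
  simpa using key Finset.univ

open Classical in
/-- The conditional distributions of the spin at `i` under the measure with density `f` with respect
to a measure with conditional distributions `κ`.  Where the density of the remaining spins vanishes,
any probability vector will do, and `κ x` is taken. -/
noncomputable def tiltedKernel (κ : (I → X) → X → ℝ) (i : I) (f : (I → X) → ℝ) (x : I → X)
    (a : X) : ℝ :=
  if expect (κ x) (fun b => f (Function.update x i b)) = 0 then κ x a
  else κ x a * f (Function.update x i a) / expect (κ x) (fun b => f (Function.update x i b))

variable {κ : (I → X) → X → ℝ} {i : I} {f q : (I → X) → ℝ}

omit [Fintype I] [DecidableEq X] in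
lemma tiltedKernel_mem_stdSimplex (hκ : ∀ x, κ x ∈ stdSimplex ℝ X) (hf : ∀ x, 0 ≤ f x)
    (x : I → X) : tiltedKernel κ i f x ∈ stdSimplex ℝ X := by
  unfold tiltedKernel
  split_ifs with h
  · exact hκ x
  · refine ⟨fun a => div_nonneg (mul_nonneg ((hκ x).1 a) (hf _))
      (expect_nonneg (hκ x).1 fun _ => hf _), ?_⟩
    rw [← Finset.sum_div]
    exact div_self h

omit [Fintype I] [DecidableEq X] in
lemma isResampling_tiltedKernel (hκ : ∀ x, κ x ∈ stdSimplex ℝ X) (hf : ∀ x, 0 ≤ f x)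
    (hq : IsResampling κ i q) :
    IsResampling (tiltedKernel κ i f) i (fun x => q x * f x) where
  congr x y hxy := by
    have h1 : ∀ a, Function.update x i a = Function.update y i a := fun a => by
      ext j
      by_cases hj : j = i
      · subst hj; simp
      · simp [Function.update_of_ne hj, hxy j hj]
    funext a
    simp only [tiltedKernel, hq.congr x y hxy, h1]
  eq_mul x := by
    set Q := ∑ b, q (Function.update x i b) with hQ
    set e := expect (κ x) (fun b => f (Function.update x i b)) with he
    have h1 : ∑ b, q (Function.update x i b) * f (Function.update x i b) = e * Q := by
      rw [he, expect, Finset.sum_mul]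
      refine Finset.sum_congr rfl fun b _ => ?_
      rw [hq.eq_mul (Function.update x i b)]
      simp only [Function.update_idem, Function.update_self, hq.update]
      ring
    have h2 : q x = κ x (x i) * Q := hq.eq_mul x
    rw [h1, tiltedKernel, ← he]
    by_cases h0 : e = 0
    · have h3 := eq_zero_of_expect_eq_zero (hκ x).1 (fun b => hf (Function.update x i b)) h0 (x i)
      rw [Function.update_eq_self] at h3
      rw [if_pos h0, h0, h2]
      linear_combination Q * h3
    · rw [if_neg h0, Function.update_eq_self, h2]
      field_simp

omit [DecidableEq X] in
/-- The average distance of the tilted from the original conditional distributions, in terms of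
the density. -/
lemma sum_mul_tv_tiltedKernel_le (hκ : ∀ x, κ x ∈ stdSimplex ℝ X) (hf : ∀ x, 0 ≤ f x)
    (hq0 : ∀ x, 0 ≤ q x) (hq : IsResampling κ i q) :
    ∑ x, q x * f x * tv (tiltedKernel κ i f x) (κ x) ≤
      (1 / 2) * expect q (fun x => expect (κ x) fun a => |f (Function.update x i a) -
        expect (κ x) fun b => f (Function.update x i b)|) := by
  have h1 := hq.sum_mul fun x => f x * tv (tiltedKernel κ i f x) (κ x)
  simp only [(isResampling_tiltedKernel hκ hf hq).update, hq.update] at h1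
  simp only [mul_assoc]
  rw [← h1, expect, Finset.mul_sum]
  refine Finset.sum_le_sum fun x _ => ?_
  rw [mul_left_comm]
  refine mul_le_mul_of_nonneg_left ?_ (hq0 x)
  set e := expect (κ x) (fun b => f (Function.update x i b)) with he
  have h2 : ∑ a, κ x a * (f (Function.update x i a) * tv (tiltedKernel κ i f x) (κ x)) =
      e * tv (tiltedKernel κ i f x) (κ x) := by
    rw [he, expect, Finset.sum_mul]
    exact Finset.sum_congr rfl fun a _ => by ring
  have he0 : 0 ≤ e := expect_nonneg (hκ x).1 fun _ => hf _
  rw [h2, tv, mul_left_comm]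
  refine mul_le_mul_of_nonneg_left ?_ (by norm_num)
  rw [Finset.mul_sum, expect]
  refine Finset.sum_le_sum fun a _ => ?_
  by_cases h0 : e = 0
  · rw [h0, zero_mul]
    exact mul_nonneg ((hκ x).1 a) (abs_nonneg _)
  · rw [tiltedKernel, ← he, if_neg h0]
    refine le_of_eq ?_
    nth_rewrite 1 [← abs_of_nonneg he0]
    rw [← abs_of_nonneg ((hκ x).1 a), ← abs_mul, ← abs_mul, abs_of_nonneg ((hκ x).1 a)]
    congr 1
    field_simp

/-- Under Dobrushin's condition, the one-site marginals of the measure with density `f` are close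
to those of `q` if its conditional distributions are: for a coupling of the two measures minimizing
the expected number of mismatches, resampling one site cannot decrease this number, so the vector `d`
of mismatch probabilities satisfies `d ≤ t + J d`, where `t` holds the average distances of the
conditional distributions.  The spins outside of `T` are frozen. -/
lemma sum_sq_tv_siteLaw_le {κ : I → (I → X) → X → ℝ} (hκ : ∀ i x, κ i x ∈ stdSimplex ℝ X)
    {J : Matrix I I ℝ}
    (hJ : ∀ i j x y, (∀ k, k ≠ j → x k = y k) → tv (κ i x) (κ i y) ≤ J i j) {α : ℝ} (hα : 0 < α)
    (hnorm : ‖Matrix.toEuclideanCLM (𝕜 := ℝ) J‖ ≤ 1 - α) {q f : (I → X) → ℝ}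
    (hq : q ∈ stdSimplex ℝ (I → X)) (hf : ∀ x, 0 ≤ f x) (hqf : expect q f = 1) {T : Finset I}
    (hT : ∀ i ∈ T, IsResampling (κ i) i q)
    (hfrozen : ∀ i, i ∉ T → ∀ x y, q x ≠ 0 → q y ≠ 0 → x i = y i) :
    α ^ 2 * ∑ i ∈ T, tv (siteLaw (fun x => q x * f x) i) (siteLaw q i) ^ 2 ≤
      ∑ i ∈ T, ((1 / 2) * expect q (fun x => expect (κ i x) fun a =>
        |f (Function.update x i a) - expect (κ i x) fun b => f (Function.update x i b)|)) ^ 2 := by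
  have hp : (fun x => q x * f x) ∈ stdSimplex ℝ (I → X) :=
    ⟨fun x => mul_nonneg (hq.1 x) (hf x), hqf⟩
  have hJ0 : ∀ i j, 0 ≤ J i j := by
    obtain ⟨x, -, -⟩ := Finset.exists_ne_zero_of_sum_ne_zero (hq.2.trans_ne one_ne_zero)
    exact fun i j => (tv_nonneg _ _).trans (hJ i j x x fun _ _ => rfl)
  obtain ⟨π, hπ, hmin⟩ := exists_isCoupling_forall_le hp hq
    (F := fun π => ∑ i, mismatch π i) (by unfold mismatch; fun_prop)
  set t : I → ℝ := fun i => if i ∈ T then (1 / 2) * expect q (fun x => expect (κ i x) fun a =>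
    |f (Function.update x i a) - expect (κ i x) fun b => f (Function.update x i b)|) else 0 with ht
  have hd : ∀ i, mismatch π i ≤ t i + ∑ j, J i j * mismatch π j := by
    intro i
    have hsum0 : 0 ≤ ∑ j, J i j * mismatch π j :=
      Finset.sum_nonneg fun j _ => mul_nonneg (hJ0 i j) (mismatch_nonneg hπ j)
    by_cases hi : i ∈ T
    · obtain ⟨π', hπ', hne, hle⟩ := exists_isCoupling_resample hπ
        (tiltedKernel_mem_stdSimplex (i := i) (hκ i) hf) (hκ i)
        (isResampling_tiltedKernel (hκ i) hf (hT i hi)) (hT i hi)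
      have h1 : mismatch π i ≤ mismatch π' i := by
        have h2 := hmin π' hπ'
        simp only [← Finset.add_sum_erase _ _ (Finset.mem_univ i)] at h2
        rw [Finset.sum_congr rfl fun j hj => hne j (Finset.ne_of_mem_erase hj)] at h2
        linarith
      have h3 : ∑ x, ∑ y, π x y * tv (tiltedKernel (κ i) i f x) (κ i y) ≤
          ∑ x, ∑ y, (π x y * tv (tiltedKernel (κ i) i f x) (κ i x) +
            ∑ j, J i j * (π x y * (if x j = y j then 0 else 1))) := by
        refine Finset.sum_le_sum fun x _ => Finset.sum_le_sum fun y _ => ?_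
        have h4 := (tv_triangle (tiltedKernel (κ i) i f x) (κ i x) (κ i y)).trans
          (add_le_add_right (tv_le_sum_mismatch (hJ i) x y) _)
        refine (mul_le_mul_of_nonneg_left h4 (hπ.nonneg x y)).trans_eq ?_
        rw [mul_add, Finset.mul_sum]
        congr 1
        exact Finset.sum_congr rfl fun j _ => by ring
      have h5 : ∑ x, ∑ y, ∑ j, J i j * (π x y * (if x j = y j then 0 else 1)) =
          ∑ j, J i j * mismatch π j := by
        simp only [mismatch, Finset.mul_sum]
        rw [Finset.sum_comm' (t' := Finset.univ) (s' := fun _ => Finset.univ) (by simp)]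
        rw [Finset.sum_congr rfl fun y _ => Finset.sum_comm, Finset.sum_comm]
        exact Finset.sum_congr rfl fun j _ => Finset.sum_comm
      simp only [Finset.sum_add_distrib] at h3
      rw [h5, hπ.sum_mul_left fun x => tv (tiltedKernel (κ i) i f x) (κ i x)] at h3
      have h6 := sum_mul_tv_tiltedKernel_le (hκ i) hf hq.1 (hT i hi)
      simp only [ht, if_pos hi]
      linarith
    · have h1 : mismatch π i = 0 := by
        refine Finset.sum_eq_zero fun x _ => Finset.sum_eq_zero fun y _ => ?_
        by_cases hxy : π x y = 0
        · simp [hxy]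
        · rw [if_pos (hfrozen i hi x y (left_ne_zero_of_mul (hπ.left_ne_zero hxy))
            (hπ.right_ne_zero hxy)), mul_zero]
      simp only [ht, if_neg hi, h1, zero_add]
      exact hsum0
  have hmain := sq_mul_sum_sq_le hα hnorm (mismatch_nonneg hπ) hd
  have h1 : ∑ i, t i ^ 2 = ∑ i ∈ T, ((1 / 2) * expect q (fun x => expect (κ i x) fun a =>
      |f (Function.update x i a) - expect (κ i x) fun b => f (Function.update x i b)|)) ^ 2 := by
    simp only [ht, ite_pow, zero_pow two_ne_zero]
    rw [Finset.sum_ite_mem, Finset.univ_inter]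
  rw [← h1]
  refine le_trans (mul_le_mul_of_nonneg_left ?_ (sq_nonneg α)) hmain
  refine (Finset.sum_le_sum fun i _ => pow_le_pow_left₀ (tv_nonneg _ _)
    (tv_siteLaw_le_mismatch hπ i) 2).trans ?_
  exact Finset.sum_le_sum_of_subset_of_nonneg (Finset.subset_univ T) fun i _ _ => sq_nonneg _

end Contraction

/-! ### Pinned measures and approximate tensorization of entropy -/

section Pinning

variable {I X : Type*} [Fintype I] [DecidableEq I] [Fintype X] [DecidableEq X]

/-- The bound of the entropies of the one-site marginals by the average conditional entropies, for
a density `f` of mean `1`.  Here `F i` is the density of the `i`-th marginal. -/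
lemma sum_ent_siteLaw_le_of_expect_eq_one {κ : I → (I → X) → X → ℝ}
    (hκ : ∀ i x, κ i x ∈ stdSimplex ℝ X) {J : Matrix I I ℝ}
    (hJ : ∀ i j x y, (∀ k, k ≠ j → x k = y k) → tv (κ i x) (κ i y) ≤ J i j) {α₁ α₂ : ℝ}
    (hα₁ : 0 < α₁) (hα₂ : 0 < α₂)
    (hnorm : ‖Matrix.toEuclideanCLM (𝕜 := ℝ) J‖ ≤ 1 - α₂) {q f : (I → X) → ℝ}
    (hq : q ∈ stdSimplex ℝ (I → X)) (hf : ∀ x, 0 ≤ f x) (hqf : expect q f = 1) {T : Finset I}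
    (hT : ∀ i ∈ T, IsResampling (κ i) i q)
    (hfrozen : ∀ i, i ∉ T → ∀ x y, q x ≠ 0 → q y ≠ 0 → x i = y i)
    (hβ : ∀ i ∈ T, ∀ a, siteLaw q i a ≠ 0 → α₁ ≤ siteLaw q i a) {F : I → X → ℝ}
    (hF0 : ∀ i a, 0 ≤ F i a)
    (hF : ∀ i ∈ T, ∀ a, siteLaw q i a * F i a = siteLaw (fun x => q x * f x) i a) :
    ∑ i ∈ T, ent (siteLaw q i) (F i) ≤ 1 / (α₁ * α₂ ^ 2) *
      ∑ i ∈ T, expect q (fun x => ent (κ i x) fun a => f (Function.update x i a)) := by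
  have hm : ∀ i, siteLaw q i ∈ stdSimplex ℝ X := fun i =>
    ⟨fun a => Finset.sum_nonneg fun x _ => by split_ifs <;> simp [hq.1 x],
      by simpa [hq.2] using sum_siteLaw_mul q i fun _ => 1⟩
  have hp1 : ∀ i, ∑ a, siteLaw (fun x => q x * f x) i a = 1 := fun i => by
    have := sum_siteLaw_mul (fun x => q x * f x) i fun _ => 1
    simp only [mul_one] at this
    exact this.trans hqf
  -- the relative entropy of the marginals is bounded by their squared distance
  have h1 : ∀ i ∈ T, ent (siteLaw q i) (F i) ≤
      2 / α₁ * tv (siteLaw (fun x => q x * f x) i) (siteLaw q i) ^ 2 := by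
    intro i hi
    have he : expect (siteLaw q i) (F i) = 1 := by
      rw [← hp1 i]; exact Finset.sum_congr rfl fun a _ => hF i hi a
    refine (ent_le_chiSq (hm i) (hF0 i) he).trans ?_
    have h2 : ∀ a, siteLaw q i a * (F i a - 1) ^ 2 ≤
        α₁⁻¹ * (siteLaw (fun x => q x * f x) i a - siteLaw q i a) ^ 2 := by
      intro a
      rw [← hF i hi a]
      by_cases h0 : siteLaw q i a = 0
      · simp [h0]
      · have h3 := hβ i hi a h0
        rw [show siteLaw q i a * F i a - siteLaw q i a = siteLaw q i a * (F i a - 1) by ring,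
          mul_pow, ← mul_assoc]
        refine mul_le_mul_of_nonneg_right ?_ (sq_nonneg _)
        rw [le_inv_mul_iff₀ hα₁, sq]
        exact mul_le_mul_of_nonneg_right h3 ((hm i).1 a)
    refine (Finset.sum_le_sum fun a _ => h2 a).trans ?_
    rw [← Finset.mul_sum]
    have h4 := sum_sq_le_of_sum_eq_zero
      (u := fun a => siteLaw (fun x => q x * f x) i a - siteLaw q i a)
      (by rw [Finset.sum_sub_distrib, hp1, (hm i).2, sub_self])
    refine (mul_le_mul_of_nonneg_left h4 (inv_nonneg.2 hα₁.le)).trans_eq ?_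
    rw [tv]; ring
  -- Pinsker's inequality for the conditional distributions
  have h5 : ∀ i ∈ T, ((1 / 2) * expect q (fun x => expect (κ i x) fun a =>
        |f (Function.update x i a) - expect (κ i x) fun b => f (Function.update x i b)|)) ^ 2 ≤
      1 / 2 * expect q (fun x => ent (κ i x) fun a => f (Function.update x i a)) := by
    intro i hi
    have h6 : expect q (fun x => 2 * expect (κ i x) fun b => f (Function.update x i b)) = 2 := by
      rw [expect_const_mul]
      have h7 : expect q (fun x => expect (κ i x) fun b => f (Function.update x i b)) = 1 :=
        ((hT i hi).sum_mul f).trans hqf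
      rw [h7, mul_one]
    have h8 : (expect q (fun x => expect (κ i x) fun a =>
        |f (Function.update x i a) - expect (κ i x) fun b => f (Function.update x i b)|)) ^ 2 ≤
        expect q (fun x => 2 * expect (κ i x) fun b => f (Function.update x i b)) *
        expect q (fun x => ent (κ i x) fun a => f (Function.update x i a)) := by
      refine Finset.sum_sq_le_sum_mul_sum_of_sq_le_mul _ (fun x _ => ?_) (fun x _ => ?_)
        fun x _ => ?_
      · exact mul_nonneg (hq.1 x) (mul_nonneg zero_le_two (expect_nonneg (hκ i x).1 fun _ => hf _))
      · exact mul_nonneg (hq.1 x) (ent_nonneg (hκ i x) fun _ => hf _)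
      · have h9 := sq_expect_abs_sub_le (hκ i x) fun a => hf (Function.update x i a)
        rw [mul_pow]
        refine (mul_le_mul_of_nonneg_left h9 (sq_nonneg _)).trans_eq ?_
        ring
    rw [h6] at h8
    rw [mul_pow]
    linarith
  have h10 := (sum_sq_tv_siteLaw_le hκ hJ hα₂ hnorm hq hf hqf hT hfrozen).trans
    (Finset.sum_le_sum h5)
  refine (Finset.sum_le_sum h1).trans ?_
  rw [← Finset.mul_sum] at h10 ⊢
  rw [div_mul_eq_mul_div, div_mul_eq_mul_div, div_le_div_iff₀ hα₁ (by positivity)]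
  linear_combination (2 * α₁) * h10

/-- The sum of the entropies of the one-site marginals is bounded by the sum of the average
conditional entropies. -/
lemma sum_ent_siteLaw_le {κ : I → (I → X) → X → ℝ}
    (hκ : ∀ i x, κ i x ∈ stdSimplex ℝ X) {J : Matrix I I ℝ}
    (hJ : ∀ i j x y, (∀ k, k ≠ j → x k = y k) → tv (κ i x) (κ i y) ≤ J i j) {α₁ α₂ : ℝ}
    (hα₁ : 0 < α₁) (hα₂ : 0 < α₂)
    (hnorm : ‖Matrix.toEuclideanCLM (𝕜 := ℝ) J‖ ≤ 1 - α₂) {q f : (I → X) → ℝ}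
    (hq : q ∈ stdSimplex ℝ (I → X)) (hf : ∀ x, 0 ≤ f x) {T : Finset I}
    (hT : ∀ i ∈ T, IsResampling (κ i) i q)
    (hfrozen : ∀ i, i ∉ T → ∀ x y, q x ≠ 0 → q y ≠ 0 → x i = y i)
    (hβ : ∀ i ∈ T, ∀ a, siteLaw q i a ≠ 0 → α₁ ≤ siteLaw q i a) {F : I → X → ℝ}
    (hF0 : ∀ i a, 0 ≤ F i a)
    (hF : ∀ i ∈ T, ∀ a, siteLaw q i a * F i a = siteLaw (fun x => q x * f x) i a) :
    ∑ i ∈ T, ent (siteLaw q i) (F i) ≤ 1 / (α₁ * α₂ ^ 2) *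
      ∑ i ∈ T, expect q (fun x => ent (κ i x) fun a => f (Function.update x i a)) := by
  by_cases he : expect q f = 0
  · have h1 : ∀ i ∈ T, ent (siteLaw q i) (F i) = 0 := by
      intro i hi
      refine ent_eq_zero_of_expect_eq_zero
        (fun a => Finset.sum_nonneg fun x _ => by split_ifs <;> simp [hq.1 x]) (hF0 i) ?_
      have h2 := sum_siteLaw_mul (fun x => q x * f x) i fun _ => 1
      simp only [mul_one] at h2
      rw [← he, expect, Finset.sum_congr rfl fun a _ => hF i hi a]
      exact h2
    rw [Finset.sum_eq_zero h1]
    exact mul_nonneg (by positivity) (Finset.sum_nonneg fun i _ =>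
      expect_nonneg hq.1 fun x => ent_nonneg (hκ i x) fun _ => hf _)
  · set e := expect q f with he'
    have hpos : 0 < e := lt_of_le_of_ne (expect_nonneg hq.1 hf) (Ne.symm he)
    have hinv : e⁻¹ ≠ 0 := inv_ne_zero he
    have h1 := sum_ent_siteLaw_le_of_expect_eq_one hκ hJ hα₁ hα₂ hnorm hq
      (f := fun x => e⁻¹ * f x) (F := fun i a => e⁻¹ * F i a)
      (fun x => mul_nonneg (inv_nonneg.2 hpos.le) (hf x))
      (by rw [expect_const_mul, ← he', inv_mul_cancel₀ he]) hT hfrozen hβ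
      (fun i a => mul_nonneg (inv_nonneg.2 hpos.le) (hF0 i a)) fun i hi a => by
        rw [mul_left_comm, hF i hi a, siteLaw, siteLaw, Finset.mul_sum]
        refine Finset.sum_congr rfl fun x _ => ?_
        split_ifs
        · ring
        · simp
    simp only [ent_const_mul _ _ hinv, expect_const_mul, ← Finset.mul_sum] at h1
    rw [mul_left_comm] at h1
    exact le_of_mul_le_mul_left h1 (inv_pos.2 hpos)

/-- The conditional distribution of the configuration under `μ` given that it agrees with `y` on
`S`; it is meaningful if `marginal μ S y` is positive, and `0` otherwise. -/
noncomputable def pinned (μ : (I → X) → ℝ) (S : Finset I) (y z : I → X) : ℝ :=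
  if ∀ j ∈ S, z j = y j then μ z / marginal μ S y else 0

variable {μ : (I → X) → ℝ}

omit [DecidableEq I] in
lemma prob_eq_sum_ite {Ω : Type*} [Fintype Ω] (ν : Ω → ℝ) (P : Ω → Prop) [DecidablePred P] :
    prob ν {z | P z} = ∑ z, if P z then ν z else 0 := by
  refine Finset.sum_congr rfl fun z _ => ?_
  by_cases h : P z <;> simp [Set.indicator, h]

lemma marginal_eq_sum (μ : (I → X) → ℝ) (S : Finset I) (y : I → X) :
    marginal μ S y = ∑ z, if ∀ j ∈ S, z j = y j then μ z else 0 :=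
  prob_eq_sum_ite μ fun z => ∀ j ∈ S, z j = y j

omit [DecidableEq X] in
lemma marginal_congr {S : Finset I} {x y : I → X} (h : ∀ j ∈ S, x j = y j) :
    marginal μ S x = marginal μ S y := by
  unfold marginal
  congr 1
  ext z
  exact forall₂_congr fun j hj => by rw [h j hj]

omit [DecidableEq X] in
lemma condProb_congr {S : Finset I} {x y : I → X} (h : ∀ j ∈ S, x j = y j) (i : I) (a : X) :
    condProb μ S i x a = condProb μ S i y a := by
  unfold condProb
  rw [marginal_congr h]
  congr 2
  ext z
  exact and_congr_left' (forall₂_congr fun j hj => by rw [h j hj])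

lemma le_marginal (hμ : ∀ x, 0 ≤ μ x) {S : Finset I} {y z : I → X} (h : ∀ j ∈ S, z j = y j) :
    μ z ≤ marginal μ S y := by
  rw [marginal_eq_sum]
  have h1 := Finset.single_le_sum (f := fun z => if ∀ j ∈ S, z j = y j then μ z else 0)
    (fun z _ => by split_ifs <;> simp [hμ z]) (Finset.mem_univ z)
  simpa only [if_pos h] using h1

omit [DecidableEq X] in
lemma condProb_eq_marginal_div {S : Finset I} {i : I} (hi : i ∉ S) (y : I → X) (a : X) :
    condProb μ S i y a = marginal μ (insert i S) (Function.update y i a) / marginal μ S y := by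
  unfold condProb
  congr 1
  unfold marginal
  congr 1
  ext z
  simp only [Set.mem_ofPred_eq, Finset.mem_insert, forall_eq_or_imp, Function.update_self]
  rw [and_comm]
  refine and_congr_right' (forall₂_congr fun j hj => ?_)
  rw [Function.update_of_ne (ne_of_mem_of_not_mem hj hi)]

lemma marginal_compl_singleton (μ : (I → X) → ℝ) (i : I) (x : I → X) :
    marginal μ {i}ᶜ x = ∑ b, μ (Function.update x i b) := by
  have h1 : ∀ b, μ (Function.update x i b) = ∑ z, if z = Function.update x i b then μ z else 0 :=
    fun b => by simp
  rw [marginal_eq_sum, Finset.sum_congr rfl fun b _ => h1 b, Finset.sum_comm]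
  refine Finset.sum_congr rfl fun z _ => ?_
  by_cases h : ∀ j ∈ ({i}ᶜ : Finset I), z j = x j
  · have h2 : ∀ b, z = Function.update x i b ↔ b = z i := by
      intro b
      constructor
      · rintro rfl; simp
      · rintro rfl
        ext j
        by_cases hj : j = i
        · subst hj; simp
        · rw [Function.update_of_ne hj, h j (by simpa using hj)]
    rw [if_pos h]
    simp [h2]
  · rw [if_neg h, Finset.sum_eq_zero]
    intro b _
    refine if_neg fun h3 => h fun j hj => ?_
    rw [h3, Function.update_of_ne (by simpa using hj)]

lemma condSite_eq_div (μ : (I → X) → ℝ) (i : I) (x : I → X) (a : X) :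
    condSite μ i x a = μ (Function.update x i a) / marginal μ {i}ᶜ x := by
  rw [condSite, condProb_eq_marginal_div (by simp)]
  congr 1
  have : insert i ({i}ᶜ : Finset I) = Finset.univ := by ext j; simp
  rw [this, marginal_eq_sum]
  simp [← funext_iff]

/-- A version of the conditional distributions resamples the spins of `μ`. -/
lemma IsCondVersion.isResampling (hμ : ∀ x, 0 ≤ μ x) {κ : I → (I → X) → X → ℝ}
    (h : IsCondVersion μ κ) (i : I) : IsResampling (κ i) i μ where
  congr := h.congr i
  eq_mul x := by
    rw [← marginal_compl_singleton]
    have h0 : μ x ≤ marginal μ {i}ᶜ x := le_marginal hμ fun _ _ => rfl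
    rcases ((hμ x).trans h0).eq_or_lt with h1 | h1
    · rw [← h1, mul_zero]; exact le_antisymm (h1 ▸ h0) (hμ x)
    · rw [h.eq_cond i x h1, condSite_eq_div, Function.update_eq_self, div_mul_cancel₀ _ h1.ne']

lemma pinned_mem_stdSimplex (hμ : ∀ x, 0 ≤ μ x) {S : Finset I} {y : I → X}
    (hy : 0 < marginal μ S y) : pinned μ S y ∈ stdSimplex ℝ (I → X) := by
  refine ⟨fun z => ?_, ?_⟩
  · unfold pinned
    have := hμ z
    split_ifs <;> positivity
  · have : ∀ z, pinned μ S y z = (if ∀ j ∈ S, z j = y j then μ z else 0) / marginal μ S y :=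
      fun z => by unfold pinned; split_ifs <;> simp
    simp only [this, ← Finset.sum_div]
    rw [← marginal_eq_sum, div_self hy.ne']

lemma eq_of_pinned_ne_zero {S : Finset I} {y z : I → X} (h : pinned μ S y z ≠ 0) :
    ∀ j ∈ S, z j = y j := by
  by_contra h1
  exact h (if_neg h1)

lemma isResampling_pinned {k : (I → X) → X → ℝ} {i : I} (h : IsResampling k i μ) {S : Finset I}
    (hi : i ∉ S) (y : I → X) : IsResampling k i (pinned μ S y) where
  congr := h.congr
  eq_mul x := by
    have h1 : ∀ b, (∀ j ∈ S, Function.update x i b j = y j) ↔ ∀ j ∈ S, x j = y j := fun b =>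
      forall₂_congr fun j hj => by rw [Function.update_of_ne (ne_of_mem_of_not_mem hj hi)]
    simp only [pinned, h1]
    split_ifs
    · rw [← Finset.sum_div, h.eq_mul x, mul_div_assoc]
    · simp

lemma condProb_mul_pinned (hμ : ∀ x, 0 ≤ μ x) {S : Finset I} {i : I} (hi : i ∉ S) (y : I → X)
    (a : X) (z : I → X) :
    condProb μ S i y a * pinned μ (insert i S) (Function.update y i a) z =
      if z i = a then pinned μ S y z else 0 := by
  have h1 : (∀ j ∈ insert i S, z j = Function.update y i a j) ↔
      z i = a ∧ ∀ j ∈ S, z j = y j := by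
    simp only [Finset.mem_insert, forall_eq_or_imp, Function.update_self]
    refine and_congr_right' (forall₂_congr fun j hj => ?_)
    rw [Function.update_of_ne (ne_of_mem_of_not_mem hj hi)]
  rw [condProb_eq_marginal_div hi]
  by_cases h2 : ∀ j ∈ insert i S, z j = Function.update y i a j
  · rw [pinned, if_pos h2, if_pos (h1.1 h2).1, pinned, if_pos (h1.1 h2).2]
    have h3 : μ z ≤ marginal μ (insert i S) (Function.update y i a) := le_marginal hμ h2
    by_cases h4 : marginal μ (insert i S) (Function.update y i a) = 0
    · have : μ z = 0 := le_antisymm (h4 ▸ h3) (hμ z)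
      simp [h4, this]
    · field_simp
  · rw [pinned, if_neg h2, mul_zero]
    by_cases h3 : z i = a
    · rw [if_pos h3, pinned, if_neg fun h4 => h2 (h1.2 ⟨h3, h4⟩)]
    · rw [if_neg h3]

lemma siteLaw_pinned (hμ : ∀ x, 0 ≤ μ x) {S : Finset I} {i : I} (hi : i ∉ S) (y : I → X) :
    siteLaw (pinned μ S y) i = condProb μ S i y := by
  funext a
  simp only [siteLaw, ← condProb_mul_pinned hμ hi y a, ← Finset.mul_sum]
  have h0 : 0 ≤ marginal μ (insert i S) (Function.update y i a) := by
    rw [marginal_eq_sum]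
    exact Finset.sum_nonneg fun z _ => by split_ifs <;> simp [hμ z]
  rcases h0.eq_or_lt with h | h
  · rw [condProb_eq_marginal_div hi, ← h]; simp
  · rw [(pinned_mem_stdSimplex hμ h).2, mul_one]

/-- Approximate tensorization of entropy for the pinned measures, by downward induction on the set
of pinned sites: averaging the chain rule over the next site to be pinned, the entropy of
its marginal is controlled by `sum_ent_siteLaw_le`, the remainder by the induction hypothesis. -/
lemma ent_pinned_le {κ : I → (I → X) → X → ℝ} (hκ : IsCondVersion μ κ) {J : Matrix I I ℝ}
    (hJ : ∀ i j x y, (∀ k, k ≠ j → x k = y k) → tv (κ i x) (κ i y) ≤ J i j) {α₁ α₂ : ℝ}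
    (hα₁ : 0 < α₁) (hα₂ : 0 < α₂)
    (hnorm : ‖Matrix.toEuclideanCLM (𝕜 := ℝ) J‖ ≤ 1 - α₂) (hμ : ∀ x, 0 ≤ μ x)
    (hβ : ∀ (S : Finset I) (i : I), i ∉ S → ∀ y, 0 < μ y → α₁ ≤ condProb μ S i y (y i))
    {f : (I → X) → ℝ} (hf : ∀ x, 0 ≤ f x) (n : ℕ) (S : Finset I) (hn : Sᶜ.card = n) (y : I → X)
    (hy : 0 < marginal μ S y) :
    ent (pinned μ S y) f ≤ 1 / (α₁ * α₂ ^ 2) * ∑ i ∈ Sᶜ,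
      expect (pinned μ S y) (fun x => ent (κ i x) fun a => f (Function.update x i a)) := by
  induction n generalizing S y with
  | zero =>
    have hS : Sᶜ = ∅ := Finset.card_eq_zero.1 hn
    have h1 : ∀ g : (I → X) → ℝ, expect (pinned μ S y) g = g y := by
      intro g
      rw [expect_congr (g := fun _ => g y), expect, ← Finset.sum_mul,
        (pinned_mem_stdSimplex hμ hy).2, one_mul]
      intro z hz
      have : z = y := funext fun j =>
        eq_of_pinned_ne_zero hz j (by rw [← Finset.notMem_compl, hS]; simp)
      rw [this]
    rw [hS, ent, h1, h1]
    simp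
  | succ n ih =>
    set q := pinned μ S y with hq
    set C := 1 / (α₁ * α₂ ^ 2) with hC
    set r : I → ℝ := fun i =>
      expect q (fun x => ent (κ i x) fun a => f (Function.update x i a)) with hr
    have hC0 : 0 ≤ C := by positivity
    set F : I → X → ℝ := fun i a => expect (pinned μ (insert i S) (Function.update y i a)) f with hF
    have hpin0 : ∀ S y z, 0 ≤ pinned μ S y z := fun S y z => by
      unfold pinned
      split_ifs
      · rw [marginal_eq_sum]
        exact div_nonneg (hμ z) (Finset.sum_nonneg fun z _ => by split_ifs <;> simp [hμ z])
      · exact le_rfl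
    have hmix : ∀ i ∈ Sᶜ, ∀ z, ∑ a, condProb μ S i y a *
        pinned μ (insert i S) (Function.update y i a) z = q z := by
      intro i hi z
      simp only [condProb_mul_pinned hμ (Finset.mem_compl.1 hi)]
      simp [hq]
    have hcond0 : ∀ i ∈ Sᶜ, ∀ a, 0 ≤ condProb μ S i y a := fun i hi a => by
      rw [← siteLaw_pinned hμ (Finset.mem_compl.1 hi)]
      exact Finset.sum_nonneg fun z _ => by split_ifs <;> simp [hpin0]
    -- the chain rule, pinning one more site
    have hstep : ∀ i ∈ Sᶜ, ent q f ≤ ent (siteLaw q i) (F i) + C * ∑ j ∈ Sᶜ.erase i, r j := by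
      intro i hi
      have hiS := Finset.mem_compl.1 hi
      rw [ent_mixture (hmix i hi) f, ← siteLaw_pinned hμ hiS]
      refine add_le_add_right ?_ _
      rw [siteLaw_pinned hμ hiS]
      have h1 : expect (condProb μ S i y)
          (fun a => ent (pinned μ (insert i S) (Function.update y i a)) f) ≤
          expect (condProb μ S i y) (fun a => C * ∑ j ∈ Sᶜ.erase i,
            expect (pinned μ (insert i S) (Function.update y i a))
              (fun x => ent (κ j x) fun a => f (Function.update x j a))) := by
        refine expect_mono (hcond0 i hi) fun a ha => ?_
        rw [← Finset.compl_insert]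
        refine ih (insert i S) ?_ _ ?_
        · rw [Finset.compl_insert, Finset.card_erase_of_mem hi, hn, Nat.add_sub_cancel]
        · have h2 := lt_of_le_of_ne (hcond0 i hi a) (Ne.symm ha)
          rw [condProb_eq_marginal_div hiS] at h2
          exact (div_pos_iff_of_pos_right hy).1 h2
      refine h1.trans_eq ?_
      rw [expect_const_mul, expect_sum]
      congr 1
      refine Finset.sum_congr rfl fun j _ => ?_
      simp only [hr, expect, ← hmix i hi, Finset.mul_sum, Finset.sum_mul]
      rw [Finset.sum_comm]
      simp only [mul_assoc]
    have hmarg : ∑ i ∈ Sᶜ, ent (siteLaw q i) (F i) ≤ C * ∑ i ∈ Sᶜ, r i := by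
      refine sum_ent_siteLaw_le hκ.mem_stdSimplex hJ hα₁ hα₂ hnorm (pinned_mem_stdSimplex hμ hy) hf
        (fun i hi => isResampling_pinned (hκ.isResampling hμ i) (Finset.mem_compl.1 hi) y)
        (fun i hi x x' hx hx' => ?_) (fun i hi a ha => ?_)
        (fun i a => expect_nonneg (hpin0 _ _) hf) fun i hi a => ?_
      · have hiS : i ∈ S := by simpa using hi
        rw [eq_of_pinned_ne_zero hx i hiS, eq_of_pinned_ne_zero hx' i hiS]
      · obtain ⟨z, -, hz⟩ := Finset.exists_ne_zero_of_sum_ne_zero ha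
        have hzi : z i = a := by by_contra h; exact hz (if_neg h)
        rw [if_pos hzi] at hz
        have hzy := eq_of_pinned_ne_zero hz
        rw [pinned, if_pos hzy] at hz
        have hμz : 0 < μ z := lt_of_le_of_ne (hμ z) fun h => hz (by rw [← h, zero_div])
        rw [siteLaw_pinned hμ (Finset.mem_compl.1 hi), ← condProb_congr hzy, ← hzi]
        exact hβ S i (Finset.mem_compl.1 hi) z hμz
      · rw [siteLaw_pinned hμ (Finset.mem_compl.1 hi)]
        simp only [hF, expect, Finset.mul_sum, siteLaw, ← mul_assoc,
          condProb_mul_pinned hμ (Finset.mem_compl.1 hi), ite_mul, zero_mul]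
    have h3 := (Finset.sum_le_sum hstep).trans_eq Finset.sum_add_distrib
    rw [Finset.sum_const, hn, nsmul_eq_mul, ← Finset.mul_sum] at h3
    have h4 : ∑ i ∈ Sᶜ, ∑ j ∈ Sᶜ.erase i, r j = n * ∑ i ∈ Sᶜ, r i := by
      have : ∀ i ∈ Sᶜ, ∑ j ∈ Sᶜ.erase i, r j = ∑ j ∈ Sᶜ, r j - r i := fun i hi => by
        rw [← Finset.add_sum_erase _ _ hi]; ring
      rw [Finset.sum_congr rfl this, Finset.sum_sub_distrib, Finset.sum_const, hn, nsmul_eq_mul]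
      push_cast
      ring
    rw [h4] at h3
    have h5 : (0 : ℝ) < (n + 1 : ℕ) := by positivity
    refine le_of_mul_le_mul_left (h3.trans ((add_le_add_left hmarg _).trans_eq ?_)) h5
    push_cast
    ring

/-- Approximate tensorization of entropy for weakly dependent spin systems. -/
lemma ent_le_sum_expect_ent {κ : I → (I → X) → X → ℝ} (hκ : IsCondVersion μ κ) {J : Matrix I I ℝ}
    (hJ : ∀ i j x y, (∀ k, k ≠ j → x k = y k) → tv (κ i x) (κ i y) ≤ J i j) {α₁ α₂ : ℝ}
    (hα₁ : 0 < α₁) (hα₂ : 0 < α₂)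
    (hnorm : ‖Matrix.toEuclideanCLM (𝕜 := ℝ) J‖ ≤ 1 - α₂) (hμ : μ ∈ stdSimplex ℝ (I → X))
    (hβ : ∀ (S : Finset I) (i : I), i ∉ S → ∀ y, 0 < μ y → α₁ ≤ condProb μ S i y (y i))
    {f : (I → X) → ℝ} (hf : ∀ x, 0 ≤ f x) :
    ent μ f ≤ 1 / (α₁ * α₂ ^ 2) * ∑ i,
      expect μ (fun x => ent (κ i x) fun a => f (Function.update x i a)) := by
  obtain ⟨y, -, -⟩ := Finset.exists_ne_zero_of_sum_ne_zero (hμ.2.trans_ne one_ne_zero)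
  have h1 : marginal μ ∅ y = 1 := by rw [marginal_eq_sum]; simpa using hμ.2
  have h2 : pinned μ ∅ y = μ := by funext z; simp [pinned, h1]
  have h3 := ent_pinned_le hκ hJ hα₁ hα₂ hnorm hμ.1 hβ hf _ ∅ rfl y (by rw [h1]; exact one_pos)
  rwa [h2, Finset.compl_empty] at h3

end Pinning

/-! ### Logarithmic Sobolev inequality for measures with large atoms -/

section LocalLogSobolev

variable {α : Type*} [Fintype α] {ν : α → ℝ}

/-- The variance as the mean squared distance of two independent copies. -/
lemma half_expect_expect_sub_sq (hν : ν ∈ stdSimplex ℝ α) (f : α → ℝ) :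
    (1 / 2) * expect ν (fun a => expect ν fun b => (f a - f b) ^ 2) =
      expect ν (fun a => f a ^ 2) - expect ν f ^ 2 := by
  have h1 : ∀ a, expect ν (fun b => (f a - f b) ^ 2) =
      f a ^ 2 + expect ν (fun b => f b ^ 2) - 2 * expect ν f * f a := by
    intro a
    have : ∀ b, ν b * (f a - f b) ^ 2 =
        f a ^ 2 * ν b + ν b * f b ^ 2 - 2 * f a * (ν b * f b) := fun b => by ring
    simp only [expect, this, Finset.sum_add_distrib, Finset.sum_sub_distrib, ← Finset.mul_sum]
    rw [show ∑ b, ν b = 1 from hν.2]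
    ring
  simp only [h1]
  have h2 : ∀ a, ν a * (f a ^ 2 + expect ν (fun b => f b ^ 2) - 2 * expect ν f * f a) =
      ν a * f a ^ 2 + expect ν (fun b => f b ^ 2) * ν a - 2 * expect ν f * (ν a * f a) :=
    fun a => by ring
  rw [expect, Finset.sum_congr rfl fun a _ => h2 a]
  simp only [Finset.sum_add_distrib, Finset.sum_sub_distrib, ← Finset.mul_sum]
  rw [show ∑ b, ν b = 1 from hν.2]
  simp only [expect]
  ring

/-- A centred function is bounded at each atom in terms of its variance. -/
lemma mul_sq_le_of_expect_eq_zero (hν : ν ∈ stdSimplex ℝ α) {g : α → ℝ} (hg : expect ν g = 0)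
    (a : α) : ν a * g a ^ 2 ≤ (1 - ν a) * expect ν (fun b => g b ^ 2) := by
  classical
  rcases (hν.1 a).eq_or_lt with h0 | h0
  · rw [← h0, zero_mul, sub_zero, one_mul]
    exact expect_nonneg hν.1 fun b => sq_nonneg _
  have h1 : ν a + ∑ b ∈ Finset.univ.erase a, ν b = 1 := by
    rw [Finset.add_sum_erase _ _ (Finset.mem_univ a)]; exact hν.2
  have h2 : ν a * g a + ∑ b ∈ Finset.univ.erase a, ν b * g b = 0 := by
    rw [Finset.add_sum_erase _ (fun b => ν b * g b) (Finset.mem_univ a)]; exact hg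
  have h3 : expect ν (fun b => g b ^ 2) =
      ν a * g a ^ 2 + ∑ b ∈ Finset.univ.erase a, ν b * g b ^ 2 :=
    (Finset.add_sum_erase _ (fun b => ν b * g b ^ 2) (Finset.mem_univ a)).symm
  have h4 : (∑ b ∈ Finset.univ.erase a, ν b * g b) ^ 2 ≤
      (∑ b ∈ Finset.univ.erase a, ν b) * ∑ b ∈ Finset.univ.erase a, ν b * g b ^ 2 :=
    Finset.sum_sq_le_sum_mul_sum_of_sq_le_mul _ (fun b _ => hν.1 b)
      (fun b _ => mul_nonneg (hν.1 b) (sq_nonneg _)) fun b _ => by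
        rw [mul_pow, sq, mul_assoc]
  have h5 : (∑ b ∈ Finset.univ.erase a, ν b * g b) ^ 2 = (ν a * g a) ^ 2 := by
    rw [eq_neg_of_add_eq_zero_right h2, neg_sq]
  rw [h5, show ∑ b ∈ Finset.univ.erase a, ν b = 1 - ν a by linarith] at h4
  rw [h3]
  nlinarith

/-- If `g` is centred with variance `V > 0` and `g² ≤ R V`, then the entropy of `(1 + g)²` is at most
`(2 + log R) V`.  Along the segment `f_t = 1 + t g` the second derivative of
`∫ f_t² log f_t² dν - (1 + t² V) log (1 + t² V)` is at most `2 (2 + log R) V`,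
by Jensen's inequality for the probability density `g² / V`. -/
lemma ent_one_add_sq_le (hν : ν ∈ stdSimplex ℝ α) {g : α → ℝ} (hg : expect ν g = 0)
    (hg1 : ∀ a, 0 ≤ 1 + g a) {V R : ℝ} (hV : 0 < V) (hR : 0 < R)
    (hgV : expect ν (fun a => g a ^ 2) = V) (hgR : ∀ a, ν a ≠ 0 → g a ^ 2 ≤ R * V) :
    ent ν (fun a => (1 + g a) ^ 2) ≤ (2 + Real.log R) * V := by
  have hν1 : ∑ a, ν a = 1 := hν.2
  set K := (2 + Real.log R) * V with hK
  have hpos : ∀ t : ℝ, 0 ≤ t → t < 1 → ∀ a, 0 < 1 + t * g a := fun t h0 h1 a => by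
    nlinarith [hg1 a]
  have hsq : ∀ t : ℝ, ∑ a, ν a * (1 + t * g a) ^ 2 = 1 + V * t ^ 2 := by
    intro t
    have : ∀ a, ν a * (1 + t * g a) ^ 2 =
        ν a + 2 * t * (ν a * g a) + t ^ 2 * (ν a * g a ^ 2) := fun a => by ring
    simp only [this, Finset.sum_add_distrib, ← Finset.mul_sum]
    rw [hν1, show ∑ a, ν a * g a = 0 from hg, show ∑ a, ν a * g a ^ 2 = V from hgV]
    ring
  have hN : ∀ t : ℝ, 0 < 1 + V * t ^ 2 := fun t => by positivity
  have hderiv_ft : ∀ (a : α) (t : ℝ), HasDerivAt (fun t => 1 + t * g a) (g a) t := fun a t => by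
    simpa using ((hasDerivAt_id t).mul_const (g a)).const_add 1
  have hderiv_mul_log : ∀ (a : α) (t : ℝ), 0 < 1 + t * g a →
      HasDerivAt (fun t => (1 + t * g a) * Real.log (1 + t * g a))
        ((Real.log (1 + t * g a) + 1) * g a) t := fun a t h => by
    have h1 := Real.hasDerivAt_mul_log h.ne'
    exact h1.comp t (hderiv_ft a t)
  have hderiv_N : ∀ t : ℝ, HasDerivAt (fun t => 1 + V * t ^ 2) (2 * V * t) t := fun t => by
    refine (((hasDerivAt_id t).pow 2).const_mul V |>.const_add 1).congr_deriv ?_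
    simp; ring
  -- half of the first derivative of `h` below
  let H : ℝ → ℝ := fun t => K * t - 2 * ∑ a, ν a * (g a *
    ((1 + t * g a) * Real.log (1 + t * g a))) + V * t * Real.log (1 + V * t ^ 2)
  let h : ℝ → ℝ := fun t => K * t ^ 2 - 2 * ∑ a, ν a * ((1 + t * g a) *
    ((1 + t * g a) * Real.log (1 + t * g a))) + (1 + V * t ^ 2) * Real.log (1 + V * t ^ 2)
  have hcont_mul_log : ∀ a, Continuous fun t => (1 + t * g a) * Real.log (1 + t * g a) :=
    fun a => Real.continuous_mul_log.comp (by fun_prop)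
  have hcont_log : Continuous fun t : ℝ => Real.log (1 + V * t ^ 2) :=
    Continuous.log (by fun_prop) fun t => (hN t).ne'
  have hH_nonneg : ∀ t ∈ Set.Icc (0 : ℝ) 1, 0 ≤ H t := by
    intro t ht
    have hder : ∀ t ∈ Set.Ioo (0 : ℝ) 1, HasDerivAt H (K - 2 * ∑ a, ν a * (g a *
        ((Real.log (1 + t * g a) + 1) * g a)) + (V * Real.log (1 + V * t ^ 2) +
        V * t * ((2 * V * t) / (1 + V * t ^ 2)))) t := by
      intro t ht
      refine HasDerivAt.add (HasDerivAt.sub ?_ ?_) ?_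
      · simpa using (hasDerivAt_id t).const_mul K
      · refine HasDerivAt.const_mul 2 (HasDerivAt.fun_sum fun a _ => ?_)
        exact ((hderiv_mul_log a t (hpos t ht.1.le ht.2 a)).const_mul (g a)).const_mul (ν a)
      · refine HasDerivAt.mul ?_ ((hderiv_N t).log (hN t).ne')
        simpa using (hasDerivAt_id t).const_mul V
    have h0 : H 0 = 0 := by simp [H]
    rw [← h0]
    refine monotoneOn_of_deriv_nonneg (convex_Icc 0 1) ?_ ?_ ?_
      (Set.left_mem_Icc.2 zero_le_one) ht ht.1
    · refine Continuous.continuousOn ?_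
      have : ∀ a, Continuous fun t => ν a * (g a * ((1 + t * g a) * Real.log (1 + t * g a))) :=
        fun a => ((hcont_mul_log a).const_mul _).const_mul _
      exact ((continuous_const.mul continuous_id).sub
        ((continuous_finsetSum _ fun a _ => this a).const_mul 2)).add
        ((continuous_const.mul continuous_id).mul hcont_log)
    · rw [interior_Icc]
      exact fun t ht => (hder t ht).differentiableAt.differentiableWithinAt
    · rw [interior_Icc]
      intro t ht
      rw [(hder t ht).deriv]
      have hfrac : 0 ≤ V * t * ((2 * V * t) / (1 + V * t ^ 2)) := by
        have := ht.1.le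
        have := hN t
        positivity
      -- Jensen's inequality, in the form `log x ≤ x - 1`
      have hJ : ∀ a, ν a * (g a ^ 2 * (2 * Real.log (1 + t * g a))) ≤
          ν a * (g a ^ 2 * (Real.log R + Real.log (1 + V * t ^ 2)) +
            V / (1 + V * t ^ 2) * (1 + t * g a) ^ 2 - g a ^ 2) := by
        intro a
        by_cases ha : ν a = 0
        · simp [ha]
        refine mul_le_mul_of_nonneg_left ?_ (hν.1 a)
        have hf := hpos t ht.1.le ht.2 a
        by_cases hga : g a = 0
        · rw [hga]
          have := hN t
          simp only [ne_eq, OfNat.ofNat_ne_zero, not_false_eq_true, zero_pow, zero_mul, zero_add,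
            sub_zero]
          positivity
        have hg2 : 0 < g a ^ 2 := by positivity
        have h1 := Real.log_le_sub_one_of_pos
          (show 0 < (1 + t * g a) ^ 2 * V / (g a ^ 2 * (1 + V * t ^ 2)) by
            have := hN t; positivity)
        rw [Real.log_div (by positivity) (mul_pos hg2 (hN t)).ne', Real.log_mul (by positivity)
          hV.ne', Real.log_mul hg2.ne' (hN t).ne', Real.log_pow] at h1
        have h2 : Real.log (g a ^ 2) ≤ Real.log R + Real.log V := by
          rw [← Real.log_mul hR.ne' hV.ne']
          exact Real.log_le_log hg2 (hgR a ha)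
        have h3 : 2 * Real.log (1 + t * g a) ≤ Real.log R + Real.log (1 + V * t ^ 2) +
            (1 + t * g a) ^ 2 * V / (g a ^ 2 * (1 + V * t ^ 2)) - 1 := by
          push_cast at h1; linarith
        refine (mul_le_mul_of_nonneg_left h3 hg2.le).trans_eq ?_
        have := (hN t).ne'
        field_simp
      have hJsum := Finset.sum_le_sum fun a (_ : a ∈ Finset.univ) => hJ a
      have h4 : ∀ a, ν a * (g a ^ 2 * (Real.log R + Real.log (1 + V * t ^ 2)) +
          V / (1 + V * t ^ 2) * (1 + t * g a) ^ 2 - g a ^ 2) =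
          (Real.log R + Real.log (1 + V * t ^ 2) - 1) * (ν a * g a ^ 2) +
          V / (1 + V * t ^ 2) * (ν a * (1 + t * g a) ^ 2) := fun a => by ring
      have h5 : ∀ a, ν a * (g a * ((Real.log (1 + t * g a) + 1) * g a)) =
          1 / 2 * (ν a * (g a ^ 2 * (2 * Real.log (1 + t * g a)))) + ν a * g a ^ 2 :=
        fun a => by ring
      simp only [h4, Finset.sum_add_distrib] at hJsum
      rw [← Finset.mul_sum, ← Finset.mul_sum, hsq, show ∑ a, ν a * g a ^ 2 = V from hgV,
        div_mul_cancel₀ _ (hN t).ne'] at hJsum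
      simp only [h5, Finset.sum_add_distrib]
      rw [← Finset.mul_sum, show ∑ a, ν a * g a ^ 2 = V from hgV]
      linarith
  have hder : ∀ t ∈ Set.Ioo (0 : ℝ) 1, HasDerivAt h (2 * H t) t := by
    intro t ht
    have h1 : HasDerivAt h (K * (2 * t) - 2 * ∑ a, ν a * (g a * ((1 + t * g a) *
        Real.log (1 + t * g a)) + (1 + t * g a) * ((Real.log (1 + t * g a) + 1) * g a)) +
        (Real.log (1 + V * t ^ 2) + 1) * (2 * V * t)) t := by
      refine HasDerivAt.add (HasDerivAt.sub ?_ ?_) ?_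
      · refine HasDerivAt.const_mul K ?_
        simpa using hasDerivAt_pow 2 t
      · refine HasDerivAt.const_mul 2 (HasDerivAt.fun_sum fun a _ => ?_)
        exact ((hderiv_ft a t).mul
          (hderiv_mul_log a t (hpos t ht.1.le ht.2 a))).const_mul (ν a)
      · exact (Real.hasDerivAt_mul_log (hN t).ne').comp t (hderiv_N t)
    refine h1.congr_deriv ?_
    have h2 : ∀ a, ν a * (g a * ((1 + t * g a) * Real.log (1 + t * g a)) +
        (1 + t * g a) * ((Real.log (1 + t * g a) + 1) * g a)) =
        2 * (ν a * (g a * ((1 + t * g a) * Real.log (1 + t * g a)))) + ν a * g a +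
          t * (ν a * g a ^ 2) := fun a => by ring
    simp only [h2, Finset.sum_add_distrib, ← Finset.mul_sum, H]
    rw [show ∑ a, ν a * g a = 0 from hg, show ∑ a, ν a * g a ^ 2 = V from hgV]
    ring
  have hmono : h 0 ≤ h 1 := by
    refine monotoneOn_of_deriv_nonneg (convex_Icc 0 1) ?_ ?_ ?_
      (Set.left_mem_Icc.2 zero_le_one) (Set.right_mem_Icc.2 zero_le_one) zero_le_one
    · refine Continuous.continuousOn ?_
      have : ∀ a, Continuous fun t => ν a * ((1 + t * g a) *
          ((1 + t * g a) * Real.log (1 + t * g a))) :=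
        fun a => ((by fun_prop : Continuous fun t => 1 + t * g a).mul
          (hcont_mul_log a)).const_mul _
      exact ((by fun_prop : Continuous fun t => K * t ^ 2).sub
        ((continuous_finsetSum _ fun a _ => this a).const_mul 2)).add
        ((by fun_prop : Continuous fun t => 1 + V * t ^ 2).mul hcont_log)
    · rw [interior_Icc]
      exact fun t ht => (hder t ht).differentiableAt.differentiableWithinAt
    · rw [interior_Icc]
      intro t ht
      rw [(hder t ht).deriv]
      exact mul_nonneg zero_le_two (hH_nonneg t ⟨ht.1.le, ht.2.le⟩)
  have h0 : h 0 = 0 := by simp [h]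
  have h1 : h 1 = K - ent ν (fun a => (1 + g a) ^ 2) := by
    have h2 : expect ν (fun a => (1 + g a) ^ 2) = 1 + V := by simpa [expect] using hsq 1
    have h3 : expect ν (fun a => (1 + g a) ^ 2 * Real.log ((1 + g a) ^ 2)) =
        2 * ∑ a, ν a * ((1 + g a) * ((1 + g a) * Real.log (1 + g a))) := by
      rw [expect, Finset.mul_sum]
      refine Finset.sum_congr rfl fun a _ => ?_
      rw [Real.log_pow]; push_cast; ring
    rw [ent, h2, h3]
    simp only [h, one_mul, one_pow, mul_one]
    ring
  linarith

/-- The logarithmic Sobolev inequality for a probability measure on a finite set all of whose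
atoms have mass at least `β`. -/
lemma ent_sq_le_of_le_atoms (hν : ν ∈ stdSimplex ℝ α) {β : ℝ} (hβ : 0 < β)
    (hatom : ∀ a, ν a ≠ 0 → β ≤ ν a) (f : α → ℝ) :
    ent ν (fun a => f a ^ 2) ≤ 2 * (Real.log (1 / β) / Real.log 2) *
      ((1 / 2) * expect ν (fun a => expect ν fun b => (f a - f b) ^ 2)) := by
  have hlog2 : 0 < Real.log 2 := Real.log_pos one_lt_two
  have hν1 : ∑ a, ν a = 1 := hν.2
  obtain ⟨a₀, -, ha₀⟩ := Finset.exists_ne_zero_of_sum_ne_zero (hν1.trans_ne one_ne_zero)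
  have hle1 : ν a₀ ≤ 1 := by
    rw [← hν1]; exact Finset.single_le_sum (fun a _ => hν.1 a) (Finset.mem_univ a₀)
  have hβ1 : β ≤ 1 := (hatom a₀ ha₀).trans hle1
  have hL0 : 0 ≤ Real.log (1 / β) := Real.log_nonneg (by rwa [le_div_iff₀ hβ, one_mul])
  have hVar0 : ∀ f : α → ℝ,
      0 ≤ (1 / 2) * expect ν (fun a => expect ν fun b => (f a - f b) ^ 2) := fun f =>
    mul_nonneg (by norm_num) (expect_nonneg hν.1 fun a => expect_nonneg hν.1 fun b => sq_nonneg _)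
  have hc0 : 0 ≤ 2 * (Real.log (1 / β) / Real.log 2) := by positivity
  rcases lt_or_ge (1 / 2) β with hβ2 | hβ2
  · -- there is only one atom
    have h1 : ∀ a, ν a ≠ 0 → a = a₀ := by
      classical
      intro a ha
      by_contra hne
      have h2 : ν a + ν a₀ ≤ 1 := by
        rw [← hν1, ← Finset.sum_pair hne]
        exact Finset.sum_le_sum_of_subset_of_nonneg (Finset.subset_univ _) fun b _ _ => hν.1 b
      linarith [hatom a ha, hatom a₀ ha₀]
    have h2 : ∀ g : α → ℝ, expect ν g = g a₀ := by
      intro g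
      rw [expect_congr (g := fun _ => g a₀) fun a ha => by rw [h1 a ha], expect, ← Finset.sum_mul,
        hν1, one_mul]
    rw [ent, h2, h2, sub_self]
    exact mul_nonneg hc0 (hVar0 f)
  -- normalized densities
  have key : ∀ f : α → ℝ, (∀ a, 0 ≤ f a) → expect ν f = 1 →
      ent ν (fun a => f a ^ 2) ≤ 2 * (Real.log (1 / β) / Real.log 2) *
        ((1 / 2) * expect ν (fun a => expect ν fun b => (f a - f b) ^ 2)) := by
    intro f hf hf1
    have hfg : ∀ a, 1 + (f a - 1) = f a := fun a => by ring
    have hg0 : expect ν (fun a => f a - 1) = 0 := by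
      have : expect ν (fun a => f a - 1) = expect ν f - ∑ a, ν a := by
        simp [expect, mul_sub, Finset.sum_sub_distrib]
      rw [this, hf1, hν1, sub_self]
    have hgV : expect ν (fun a => (f a - 1) ^ 2) =
        (1 / 2) * expect ν (fun a => expect ν fun b => (f a - f b) ^ 2) := by
      have := half_expect_expect_sub_sq hν (fun a => f a - 1)
      rw [hg0] at this
      simp only [sub_sub_sub_cancel_right] at this
      rw [this]; ring
    rw [← hgV]
    set V := expect ν (fun a => (f a - 1) ^ 2) with hV
    have hV0 : 0 ≤ V := expect_nonneg hν.1 fun a => sq_nonneg _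
    rcases hV0.eq_or_lt with h0 | hVpos
    · have h1 : ∀ a, ν a ≠ 0 → f a ^ 2 = 1 := fun a ha => by
        have h2 := (mul_eq_zero.1 (eq_zero_of_expect_eq_zero hν.1 (fun a => sq_nonneg (f a - 1))
          h0.symm a)).resolve_left ha
        rw [pow_eq_zero_iff two_ne_zero, sub_eq_zero] at h2
        rw [h2, one_pow]
      rw [ent_congr h1, ← h0]
      simp [ent, expect, hν1]
    have hR : 0 < 1 / β - 1 := by
      rw [sub_pos, lt_div_iff₀ hβ]; linarith
    have h1 := ent_one_add_sq_le hν hg0 (fun a => by rw [hfg]; exact hf a) hVpos hR rfl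
      fun a ha => by
        have h2 := mul_sq_le_of_expect_eq_zero hν hg0 a
        have h3 := hatom a ha
        rw [← hV] at h2
        have h4 : 0 < ν a := hβ.trans_le h3
        have h5 : (f a - 1) ^ 2 ≤ (1 / ν a - 1) * V := by
          rw [show (1 / ν a - 1) * V = (1 - ν a) * V / ν a by field_simp, le_div_iff₀ h4]
          linarith
        refine h5.trans (mul_le_mul_of_nonneg_right ?_ hV0)
        exact sub_le_sub_right (one_div_le_one_div_of_le hβ h3) 1
    simp only [hfg] at h1
    refine h1.trans (mul_le_mul_of_nonneg_right ?_ hV0)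
    -- `1 / β - 1 ≤ (1 / (2 β))²`, as `β (1 - β) ≤ 1 / 4`
    have h2 : Real.log (1 / β - 1) ≤ 2 * (Real.log (1 / β) - Real.log 2) := by
      have h3 : 1 / β - 1 ≤ (1 / β / 2) ^ 2 := by
        have : (1 / β / 2) ^ 2 - (1 / β - 1) = (1 / β / 2 - 1) ^ 2 := by ring
        linarith [sq_nonneg (1 / β / 2 - 1)]
      refine (Real.log_le_log hR h3).trans_eq ?_
      rw [Real.log_pow, Real.log_div (by positivity) two_ne_zero]
      push_cast; ring
    have h4 : Real.log 2 ≤ Real.log (1 / β) := by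
      refine Real.log_le_log two_pos ?_
      rw [le_div_iff₀ hβ]; linarith
    have h5 : Real.log 2 ≤ 1 := by linarith [Real.log_two_lt_d9]
    have h6 : Real.log (1 / β) - Real.log 2 ≤ Real.log (1 / β) / Real.log 2 - 1 := by
      rw [show Real.log (1 / β) / Real.log 2 - 1 =
        (Real.log (1 / β) - Real.log 2) / Real.log 2 by field_simp, le_div_iff₀ hlog2]
      exact mul_le_of_le_one_right (sub_nonneg.2 h4) h5
    linarith
  -- reduction to `f ≥ 0`
  have habs : ∀ f : α → ℝ, (∀ a, 0 ≤ f a) →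
      ent ν (fun a => f a ^ 2) ≤ 2 * (Real.log (1 / β) / Real.log 2) *
        ((1 / 2) * expect ν (fun a => expect ν fun b => (f a - f b) ^ 2)) := by
    intro f hf
    by_cases he : expect ν f = 0
    · have h1 : ∀ a, ν a ≠ 0 → f a ^ 2 = 0 := fun a ha => by
        rw [(mul_eq_zero.1 (eq_zero_of_expect_eq_zero hν.1 hf he a)).resolve_left ha]; simp
      rw [ent_congr h1]
      refine le_trans (le_of_eq ?_) (mul_nonneg hc0 (hVar0 f))
      simp [ent, expect]
    · set e := expect ν f with he'
      have hpos : 0 < e := lt_of_le_of_ne (expect_nonneg hν.1 hf) (Ne.symm he)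
      have h1 := key (fun a => e⁻¹ * f a) (fun a => mul_nonneg (inv_nonneg.2 hpos.le) (hf a))
        (by rw [expect_const_mul, ← he', inv_mul_cancel₀ he])
      simp only [← mul_sub, mul_pow, expect_const_mul] at h1
      rw [ent_const_mul _ _ (pow_ne_zero 2 (inv_ne_zero he)), mul_left_comm (1 / 2 : ℝ),
        mul_left_comm] at h1
      exact le_of_mul_le_mul_left h1 (pow_pos (inv_pos.2 hpos) 2)
  have h1 := habs (fun a => |f a|) fun a => abs_nonneg _
  simp only [sq_abs] at h1
  refine h1.trans (mul_le_mul_of_nonneg_left (mul_le_mul_of_nonneg_left ?_ (by norm_num)) hc0)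
  exact expect_mono hν.1 fun a _ => expect_mono hν.1 fun b _ =>
    sq_le_sq.2 (abs_abs_sub_abs_le _ _)

end LocalLogSobolev

/-! ### Glauber dynamics and the functional inequalities -/

section Glauber

variable {I X : Type*} [Fintype I] [DecidableEq I] [Fintype X] [DecidableEq X]
  {μ : (I → X) → ℝ}

/-- A step of the Glauber dynamics resamples a uniformly chosen site. -/
lemma sum_glauber_mul (μ : (I → X) → ℝ) (x : I → X) (g : (I → X) → ℝ) :
    ∑ y, glauber μ x y * g y =
      (Fintype.card I : ℝ)⁻¹ * ∑ i, ∑ a, condSite μ i x a * g (Function.update x i a) := by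
  have h1 : ∀ i y, (∏ j ∈ Finset.univ.erase i, if x j = y j then (1 : ℝ) else 0) =
      ∑ a, if y = Function.update x i a then 1 else 0 := by
    intro i y
    by_cases h : ∀ j, j ≠ i → x j = y j
    · have h2 : ∀ a, y = Function.update x i a ↔ a = y i := by
        intro a
        constructor
        · rintro rfl; simp
        · rintro rfl
          ext j
          by_cases hj : j = i
          · subst hj; simp
          · rw [Function.update_of_ne hj, h j hj]
      rw [Finset.prod_eq_one fun j hj => if_pos (h j (Finset.ne_of_mem_erase hj))]
      simp [h2]
    · push Not at h
      obtain ⟨j, hj, hne⟩ := h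
      rw [Finset.prod_eq_zero (Finset.mem_erase.2 ⟨hj, Finset.mem_univ j⟩) (if_neg hne),
        Finset.sum_eq_zero]
      intro a _
      refine if_neg ?_
      rintro rfl
      exact hne (Function.update_of_ne hj _ _).symm
  simp only [glauber, h1, Finset.mul_sum, Finset.sum_mul]
  rw [Finset.sum_comm]
  refine Finset.sum_congr rfl fun i _ => ?_
  rw [Finset.sum_comm]
  refine Finset.sum_congr rfl fun a _ => ?_
  rw [Finset.sum_eq_single (Function.update x i a)]
  · rw [if_pos rfl, Function.update_self]; ring
  · intro y _ hy
    rw [if_neg hy]; ring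
  · simp

lemma condSite_nonneg (hμ : ∀ x, 0 ≤ μ x) (i : I) (x : I → X) (a : X) : 0 ≤ condSite μ i x a := by
  rw [condSite_eq_div, marginal_compl_singleton]
  exact div_nonneg (hμ _) (Finset.sum_nonneg fun b _ => hμ _)

lemma glauber_update_pos (hμ : ∀ x, 0 ≤ μ x) {i : I} {x : I → X} {a : X}
    (h : 0 < condSite μ i x a) : 0 < glauber μ x (Function.update x i a) := by
  have : 0 < Fintype.card I := Fintype.card_pos_iff.2 ⟨i⟩
  refine mul_pos (by positivity) (Finset.sum_pos' (fun j _ => ?_) ⟨i, Finset.mem_univ i, ?_⟩)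
  · exact mul_nonneg (condSite_nonneg hμ _ _ _)
      (Finset.prod_nonneg fun k _ => by split_ifs <;> norm_num)
  · rw [Function.update_self, Finset.prod_eq_one, mul_one]
    · exact h
    · intro j hj
      rw [if_pos]
      rw [Function.update_of_ne (Finset.ne_of_mem_erase hj)]

lemma IsCondVersion.eq_condSite (hμ : ∀ x, 0 ≤ μ x) {κ : I → (I → X) → X → ℝ}
    (h : IsCondVersion μ κ) (i : I) {x : I → X} (hx : μ x ≠ 0) : κ i x = condSite μ i x :=
  h.eq_cond i x ((lt_of_le_of_ne (hμ x) (Ne.symm hx)).trans_le (le_marginal hμ fun _ _ => rfl))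

/-- The average conditional entropies at one site are bounded by the part of the Dirichlet form
belonging to that site. -/
lemma expect_ent_le_expect_mul_log_sub (hμ : ∀ x, 0 ≤ μ x) {κ : I → (I → X) → X → ℝ}
    (hκ : IsCondVersion μ κ) (i : I) {f : (I → X) → ℝ} (hf : ∀ x, 0 ≤ f x)
    (hpos : ∀ x y, 0 < μ x → 0 < glauber μ x y → 0 < f x → 0 < f y) :
    expect μ (fun x => ent (κ i x) fun a => f (Function.update x i a)) ≤
      expect μ (fun x => f x *
        (Real.log (f x) - ∑ a, condSite μ i x a * Real.log (f (Function.update x i a)))) := by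
  have hres := hκ.isResampling hμ i
  rw [expect_congr (f := fun x => f x * _) (g := fun x => f x *
    (Real.log (f x) - ∑ a, κ i x a * Real.log (f (Function.update x i a))))
    fun x hx => by rw [hκ.eq_condSite hμ i hx]]
  rw [show expect μ (fun x => f x *
    (Real.log (f x) - ∑ a, κ i x a * Real.log (f (Function.update x i a)))) = _ from
    (hres.sum_mul _).symm]
  simp only [hres.update, Function.update_idem]
  refine expect_mono hμ fun x hx => ?_
  have hμa : ∀ a, κ i x a ≠ 0 → 0 < μ (Function.update x i a) := by
    intro a ha
    rw [hres.eq_mul, hres.update, Function.update_self]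
    simp only [Function.update_idem]
    rw [← marginal_compl_singleton]
    exact mul_pos (lt_of_le_of_ne ((hκ.mem_stdSimplex i x).1 a) (Ne.symm ha))
      ((lt_of_le_of_ne (hμ x) (Ne.symm hx)).trans_le (le_marginal hμ fun _ _ => rfl))
  by_cases h : ∃ a, κ i x a ≠ 0 ∧ f (Function.update x i a) ≠ 0
  · -- by `hpos`, the density is positive at all atoms
    obtain ⟨a, ha, hfa⟩ := h
    refine ent_le_cov_log (hκ.mem_stdSimplex i x) fun b hb => ?_
    refine hpos (Function.update x i a) _ (hμa a ha) ?_ (lt_of_le_of_ne (hf _) (Ne.symm hfa))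
    have h1 : 0 < condSite μ i (Function.update x i a) b := by
      rw [← hκ.eq_condSite hμ i (hμa a ha).ne', hres.update]
      exact lt_of_le_of_ne ((hκ.mem_stdSimplex i x).1 b) (Ne.symm hb)
    have h2 := glauber_update_pos hμ h1
    rwa [Function.update_idem] at h2
  · push Not at h
    rw [ent_congr h]
    refine le_of_eq ?_
    rw [Finset.sum_eq_zero]
    · simp [ent, expect]
    · intro a _
      by_cases ha : κ i x a = 0
      · simp [ha]
      · simp [h a ha]

lemma card_mul_dirichletForm_glauber [Nonempty I] (μ f g : (I → X) → ℝ) :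
    Fintype.card I * dirichletForm (glauber μ) μ f g = ∑ i, expect μ (fun x => f x *
      (g x - ∑ a, condSite μ i x a * g (Function.update x i a))) := by
  have hn : (Fintype.card I : ℝ) ≠ 0 := by simp
  rw [dirichletForm, ← expect_const_mul, ← expect_sum]
  congr 1
  funext x
  rw [sum_glauber_mul, ← Finset.mul_sum, Finset.sum_sub_distrib, Finset.sum_const,
    Finset.card_univ, nsmul_eq_mul]
  field_simp

end Glauber

end SpinSystem

open SpinSystem

theorem theorem4p1 {I X : Type*} [Fintype I] [DecidableEq I] [Fintype X] [DecidableEq X]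
    (μ : (I → X) → ℝ) (hμ : μ ∈ stdSimplex ℝ (I → X))
    (α₁ α₂ : ℝ) (hα₁ : 0 < α₁) (hα₂ : 0 < α₂)
    (hdep : SpinSystem.IsWeaklyDependent μ α₁ α₂) :
    (∀ f : (I → X) → ℝ, (∀ x, 0 ≤ f x) → (∀ x, μ x = 0 → f x = 0) →
      SpinSystem.ent μ f ≤ 1 / (α₁ * α₂ ^ 2) *
        ∑ i, SpinSystem.expect μ (fun x =>
          SpinSystem.ent (SpinSystem.condSite μ i x) (fun a => f (Function.update x i a)))) ∧
    SpinSystem.IsMLSI (SpinSystem.glauber μ) μ (2 * Fintype.card I * α₁⁻¹ * (α₂ ^ 2)⁻¹) ∧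
    SpinSystem.IsLSI (SpinSystem.gradNorm μ) μ
      (Real.log (1 / α₁) / (Real.log 2 * α₁ * α₂ ^ 2)) := by
  obtain ⟨J, ⟨-, κ, hκ, hJ⟩, hbeta, hnorm⟩ := hdep
  have hβ : ∀ (S : Finset I) (i : I), i ∉ S → ∀ y, 0 < μ y → α₁ ≤ condProb μ S i y (y i) := by
    intro S i hi y hy
    simp only [betaTilde, betaTildeAt, le_iInf_iff, EReal.coe_le_coe_iff] at hbeta
    exact hbeta S (Finset.ssubset_univ_iff.2 fun h => hi (h ▸ Finset.mem_univ i)) i hi y hy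
  have hmain : ∀ f : (I → X) → ℝ, (∀ x, 0 ≤ f x) → ent μ f ≤ 1 / (α₁ * α₂ ^ 2) * ∑ i,
      expect μ (fun x => ent (κ i x) fun a => f (Function.update x i a)) := fun f hf =>
    ent_le_sum_expect_ent hκ hJ hα₁ hα₂ hnorm hμ hβ hf
  refine ⟨fun f hf _ => ?_, fun f hf hpos => ?_, fun f => ?_⟩
  · refine (hmain f hf).trans_eq ?_
    congr 1
    exact Finset.sum_congr rfl fun i _ => expect_congr fun x hx => by
      rw [hκ.eq_condSite hμ.1 i hx]
  · have h1 := hmain f hf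
    rcases isEmpty_or_nonempty I with hI | hI
    · simpa using h1
    · refine (h1.trans (mul_le_mul_of_nonneg_left (Finset.sum_le_sum fun i _ =>
        expect_ent_le_expect_mul_log_sub hμ.1 hκ i hf hpos) (by positivity))).trans_eq ?_
      rw [← card_mul_dirichletForm_glauber μ f fun x => Real.log (f x)]
      field_simp
  · have h1 := hmain (fun x => f x ^ 2) fun x => sq_nonneg _
    set c := 2 * (Real.log (1 / α₁) / Real.log 2) with hc
    have h2 : ∀ i, expect μ (fun x => ent (κ i x) fun a => f (Function.update x i a) ^ 2) ≤
        c * expect μ (fun x => localVar μ i f x) := by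
      intro i
      rw [← expect_const_mul]
      refine expect_mono hμ.1 fun x hx => ?_
      have hmarg : 0 < marginal μ {i}ᶜ x :=
        (lt_of_le_of_ne (hμ.1 x) (Ne.symm hx)).trans_le (le_marginal hμ.1 fun _ _ => rfl)
      rw [localVar, if_pos hmarg, ← hκ.eq_cond i x hmarg]
      refine ent_sq_le_of_le_atoms (hκ.mem_stdSimplex i x) hα₁ (fun a ha => ?_)
        fun a => f (Function.update x i a)
      rw [hκ.eq_cond i x hmarg] at ha ⊢
      have h3 : μ (Function.update x i a) ≠ 0 := fun h0 => ha (by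
        rw [condSite_eq_div, h0, zero_div])
      have h4 := hβ {i}ᶜ i (by simp) (Function.update x i a)
        (lt_of_le_of_ne (hμ.1 _) (Ne.symm h3))
      rwa [Function.update_self, condProb_congr (y := x) fun j hj =>
        Function.update_of_ne (by simpa using hj) _ _] at h4
    have h3 : ∀ x, gradNorm μ f x ^ 2 = ∑ i, localVar μ i f x := by
      intro x
      refine Real.sq_sqrt (Finset.sum_nonneg fun i _ => ?_)
      unfold localVar
      split_ifs
      · exact mul_nonneg (by norm_num) (expect_nonneg (condSite_nonneg hμ.1 i x) fun a =>
          expect_nonneg (condSite_nonneg hμ.1 i x) fun b => sq_nonneg _)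
      · exact le_rfl
    refine (h1.trans (mul_le_mul_of_nonneg_left (Finset.sum_le_sum fun i _ => h2 i)
      (by positivity))).trans_eq ?_
    simp only [h3]
    rw [expect_sum, ← Finset.mul_sum, hc]
    field_simp
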